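/- Let $k\ge 1$ and let $\mathcal P_2(\mathbb R^k)$ be the set of Borel probability measures on $\mathbb R^k$ with finite second moment. On $\mathcal P_2$ (over $\mathbb R^k$ or $\mathbb R$) put $W_2(\mu,\nu)^2=\inf_{\pi}\int\frac12|x-y|^2\,\pi(dx,dy)$, the infimum being over all couplings $\pi$ of $\mu$ and $\nu$. For $\theta\in\mathcal S^{k-1}$ let $\mu_\theta$ be the image of $\mu$ under $x\mapsto\theta^\top x$, let $d\theta$ be the uniform probability measure on $\mathcal S^{k-1}$, and set $SW_2(\mu,\nu)^2=\int_{\mathcal S^{k-1}}W_2(\mu_\theta,\nu_\theta)^2\,d\theta$. For $\sigma>0$ let $\mathcal N_\sigma$ be the normal distribution on $\mathbb R^k$ with mean $0$ and covariance $\sigma^2I_k$, $\mu^\sigma=\mu*\mathcal N_\sigma$, $SW_2^\sigma(\mu,\nu)=SW_2(\mu^\sigma,\nu^\sigma)$, and $T_\theta^\sigma=F_{\nu^\sigma_\theta}^{-1}\circ F_{\mu^\sigma_\theta}$, where $F_\rho$ is the cumulative distribution function of $\rho$ and $\mu^\sigma_\theta=(\mu^\sigma)_\theta$. The $L$-derivative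 of $u:\mathcal P_2(\mathbb R^k)\to\mathbb R$ is the function $D_\mu u:\mathcal P_2(\mathbb R^k)\times\mathbb R^k\to\mathbb R^k$, jointly continuous for $W_2$ and the Euclidean distance, such that on every atomless probability space the lift $X\mapsto u(\mathbb P_X)$ is Fréchet differentiable at every $X\in L^2(\Omega;\mathbb R^k)$ with gradient $D_\mu u(\mathbb P_X)(X)$. We write $D^2_{x\mu}u(\mu)(x)$ for the derivative (Jacobian) of $x\mapsto D_\mu u(\mu)(x)$, and $|\cdot|$ for the operator norm of a matrix. There is a constant $C>0$, depending only on $k$, such that for all $\sigma>0$ and $\nu\in\mathcal P_2(\mathbb R^k)$ the function $\mu\mapsto SW_2^\sigma(\mu,\nu)^2$ has an $L$-derivative, and for every $\mu\in\mathcal P_2(\mathbb R^k)$: the maps $T^\sigma_\theta$ are differentiable; the $L$-derivative at $\mu$ is differentiable in $x$ at every $x\in\mathbb R^k$, with $$D^2_{x\mu}SW_2^\sigma(\mu,\nu)^2(x)=\mathbb E\int_{\mathcal S^{k-1}}\theta\theta^\top\bigl(1-(T^\sigma_\theta)'(\theta^\top(x+N_\sigma))\bigr)\,d\theta,\qquad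 N_\sigma\sim\mathcal N_\sigma,$$ where the integrand is integrable jointly in $(N_\sigma,\theta)$; and $$\int_{\mathbb R^k}\bigl|D^2_{x\mu}SW_2^\sigma(\mu,\nu)^2(x)\bigr|\,\mu(dx)\le C\Bigl(1+\frac1\sigma\Bigl(\int_{\mathbb R^k}|y|^2\,\nu^\sigma(dy)\Bigr)^{1/2}\Bigr).$$ -/

import Mathlib

open MeasureTheory ProbabilityTheory

namespace SlicedW

/-- The Euclidean space `ℝᵏ`. -/
abbrev Euc (k : ℕ) : Type := EuclideanSpace ℝ (Fin k)

/-- The unit sphere of `ℝᵏ`. -/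
abbrev Sph (k : ℕ) : Type := Metric.sphere (0 : Euc k) 1

/-- Borel probability measures on `ℝᵏ` with finite second moment. -/
def P2 (k : ℕ) : Type :=
  {μ : Measure (Euc k) // IsProbabilityMeasure μ ∧ MemLp id 2 μ}

/-- Probability measures on the product with marginals `μ` and `ν`. -/
def couplings {F : Type*} [MeasurableSpace F] (μ ν : Measure F) : Set (Measure (F × F)) :=
  {π | IsProbabilityMeasure π ∧ π.map Prod.fst = μ ∧ π.map Prod.snd = ν}

/-- The squared Wasserstein distance, for the cost `|x - y|² / 2`. -/
noncomputable def W2sq {F : Type*} [NormedAddCommGroup F] [MeasurableSpace F]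
    (μ ν : Measure F) : ℝ :=
  (⨅ π ∈ couplings μ ν, ∫⁻ p, ENNReal.ofReal (‖p.1 - p.2‖ ^ 2 / 2) ∂π).toReal

/-- The Wasserstein distance on `P2 k`. -/
noncomputable def W2 {k : ℕ} (μ ν : P2 k) : ℝ := Real.sqrt (W2sq μ.1 ν.1)

/-- The rotation-invariant probability measure on the sphere. -/
noncomputable def unif (k : ℕ) : Measure (Sph k) :=
  ((volume : Measure (Euc k)).toSphere Set.univ)⁻¹ • (volume : Measure (Euc k)).toSphere

/-- The push-forward of `μ` under `x ↦ θᵀ x`. -/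
noncomputable def slice {k : ℕ} (θ : Sph k) (μ : Measure (Euc k)) : Measure ℝ :=
  μ.map (fun x => inner ℝ (θ : Euc k) x)

/-- The squared sliced Wasserstein distance. -/
noncomputable def SW2sq {k : ℕ} (μ ν : Measure (Euc k)) : ℝ :=
  ∫ θ, W2sq (slice θ μ) (slice θ ν) ∂(unif k)

/-- The centred normal distribution on `ℝᵏ` with covariance `σ² I`. -/
noncomputable def gauss (k : ℕ) (σ : ℝ) : Measure (Euc k) :=
  multivariateGaussian 0 (σ ^ 2 • (1 : Matrix (Fin k) (Fin k) ℝ))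

/-- The convolution of `μ` with the centred normal distribution with covariance `σ² I`. -/
noncomputable def reg {k : ℕ} (σ : ℝ) (μ : Measure (Euc k)) : Measure (Euc k) :=
  μ.conv (gauss k σ)

/-- The squared Gaussian regularized sliced Wasserstein distance. -/
noncomputable def SW2regSq {k : ℕ} (σ : ℝ) (μ ν : P2 k) : ℝ :=
  SW2sq (reg σ μ.1) (reg σ ν.1)

/-- The inverse of the cumulative distribution function of `ρ`. -/
noncomputable def quantile (ρ : Measure ℝ) (p : ℝ) : ℝ := sInf {y | p ≤ cdf ρ y}

/-- The monotone transport map between the slices in direction `θ` of the regularizations of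
`μ` and `ν`. -/
noncomputable def transportMap {k : ℕ} (σ : ℝ) (μ ν : P2 k) (θ : Sph k) (t : ℝ) : ℝ :=
  quantile (slice θ (reg σ ν.1)) (cdf (slice θ (reg σ μ.1)) t)

/-- Every event of positive probability contains one of strictly smaller positive probability.
(`NoAtoms` only says that points are null.) -/
def IsAtomless {Ω : Type*} [MeasurableSpace Ω] (P : Measure Ω) : Prop :=
  ∀ A, MeasurableSet A → 0 < P A → ∃ B, MeasurableSet B ∧ B ⊆ A ∧ 0 < P B ∧ P B < P A

/-- The law of a square-integrable random vector. -/
noncomputable def law {k : ℕ} {Ω : Type*} [MeasurableSpace Ω] (P : Measure Ω)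
    [IsProbabilityMeasure P] (X : Lp (Euc k) 2 P) : P2 k :=
  ⟨P.map X, Measure.isProbabilityMeasure_map (Lp.aestronglyMeasurable X).aemeasurable,
    (memLp_map_measure_iff aestronglyMeasurable_id
      (Lp.aestronglyMeasurable X).aemeasurable).2 (Lp.memLp X)⟩

/-- Joint continuity on `P2 k × ℝᵏ`, with the Wasserstein distance on the first factor. -/
def JointlyContinuous {k : ℕ} (D : P2 k → Euc k → Euc k) : Prop :=
  ∀ μ x, ∀ ε > 0, ∃ δ > 0, ∀ μ' x', W2 μ' μ < δ → ‖x' - x‖ < δ → ‖D μ' x' - D μ x‖ < ε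

/-- `D` is the `L`-derivative of `u`: it is jointly continuous, and at every `X` in `L²(Ω; ℝᵏ)`
the lift `X ↦ u (law X)` is Fréchet differentiable with gradient `D (law X) (X)`. -/
def IsLDerivative {k : ℕ} {Ω : Type*} [MeasurableSpace Ω] (P : Measure Ω)
    [IsProbabilityMeasure P] (u : P2 k → ℝ) (D : P2 k → Euc k → Euc k) : Prop :=
  JointlyContinuous D ∧
    ∀ X : Lp (Euc k) 2 P, ∃ h : MemLp (fun ω => D (law P X) (X ω)) 2 P,
      HasGradientAt (fun Y : Lp (Euc k) 2 P => u (law P Y)) (h.toLp _) X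

/-- `θ θᵀ (1 - T'(θᵀ (x + z)))`, as a linear map on `ℝᵏ`. -/
noncomputable def hessIntegrand {k : ℕ} (σ : ℝ) (μ ν : P2 k) (x z : Euc k) (θ : Sph k) :
    Euc k →L[ℝ] Euc k :=
  (1 - deriv (transportMap σ μ ν θ) (inner ℝ (θ : Euc k) (x + z))) •
    InnerProductSpace.rankOne ℝ (θ : Euc k) (θ : Euc k)

end SlicedW

open SlicedW

/-!
Write `N = N_σ` and let `T_θ` be the monotone transport map from `μ^σ_θ` to `ν^σ_θ`. In dimension
one this transport is optimal, so for `X` with law `μ` the lift of `SW_2^σ(·, ν)^2` at `X` is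
`½ ‖A X‖²`, with the residual `A X = θᵀ(X + N) - T_θ(θᵀ(X + N))` in `L²` of `(ω, N, θ)`. The map
`T_θ` built at `X` still gives an admissible coupling at a nearby `Z`, whence the upper bound
`½ ‖A X + θᵀ(Z - X)‖²` for the lift at `Z`, with equality at `Z = X`. Such quadratic bounds from
above at all base points, together with the continuity of `A`, force Fréchet differentiability, with
gradient `∫ θ A(X) dθ` averaged over `N`.

For fixed `x` the gradient is the Gaussian average of a function of `θᵀ(x + N)`. Moving `x` into the
Gaussian density makes all derivatives in `x` fall on the density, and an integration by parts turns
the derivative of the density into that of `T_θ`. By Stein's identity and the Cauchy-Schwarz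
inequality `E T_θ'(θᵀ(x + N))` is at most `σ⁻¹ (E T_θ(θᵀ(x + N))²)^{1/2}`; integrated in `x` against
`μ` the second moment becomes that of `ν^σ_θ`, since `T_θ` pushes `μ^σ_θ` to `ν^σ_θ`.
-/

namespace SlicedW

open Set Filter Topology
open scoped NNReal RealInnerProductSpace

/-! ### Monotone rearrangement on the line -/

/-- Regularity of a distribution on the line, in the form that makes its quantile function a
differentiable inverse of its distribution function: the distribution function has a positive
derivative at every point. -/
def RegularCDF (ρ : Measure ℝ) : Prop := ∀ t, ∃ d, 0 < d ∧ HasDerivAt (cdf ρ) d t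

/-- The monotone rearrangement of `ρ` onto `η`. -/
noncomputable def monoMap (ρ η : Measure ℝ) (t : ℝ) : ℝ := quantile η (cdf ρ t)

lemma sq_mul_le_integral_sq_of_le_cdf {η : Measure ℝ} [IsProbabilityMeasure η]
    (h2 : Integrable (fun y => y ^ 2) η) {a c : ℝ} (hc : c ≤ cdf η a) (hc' : c ≤ 1 - cdf η a) :
    a ^ 2 * c ≤ ∫ y, y ^ 2 ∂η := by
  have markov : a ^ 2 * η.real {y | a ^ 2 ≤ y ^ 2} ≤ ∫ y, y ^ 2 ∂η :=
    mul_meas_ge_le_integral_of_nonneg (ae_of_all _ fun y => sq_nonneg y) h2 _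
  refine le_trans (mul_le_mul_of_nonneg_left ?_ (sq_nonneg a)) markov
  rw [cdf_eq_real] at hc hc'
  rcases le_total 0 a with ha | ha
  · rw [← probReal_compl_eq_one_sub measurableSet_Iic, compl_Iic] at hc'
    exact hc'.trans (measureReal_mono fun y (hy : a < y) => pow_le_pow_left₀ ha hy.le 2)
  · exact hc.trans (measureReal_mono fun y (hy : y ≤ a) =>
      sq_le_sq.2 (abs_le_abs_of_nonpos ha hy))

namespace RegularCDF

variable {ρ η : Measure ℝ}

lemma differentiable (h : RegularCDF ρ) : Differentiable ℝ (cdf ρ) := fun t =>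
  let ⟨_, _, hd⟩ := h t; hd.differentiableAt

lemma continuous (h : RegularCDF ρ) : Continuous (cdf ρ) := h.differentiable.continuous

lemma strictMono (h : RegularCDF ρ) : StrictMono (cdf ρ) :=
  strictMono_of_deriv_pos fun t => let ⟨_, h0, hd⟩ := h t; hd.deriv ▸ h0

lemma cdf_mem_Ioo (h : RegularCDF ρ) (t : ℝ) : cdf ρ t ∈ Ioo (0 : ℝ) 1 :=
  ⟨(cdf_nonneg ρ (t - 1)).trans_lt (h.strictMono (sub_one_lt t)),
    (h.strictMono (lt_add_one t)).trans_le (cdf_le_one ρ _)⟩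

lemma exists_cdf_eq (h : RegularCDF ρ) {p : ℝ} (hp : p ∈ Ioo (0 : ℝ) 1) : ∃ t, cdf ρ t = p := by
  obtain ⟨a, ha⟩ := ((tendsto_cdf_atBot ρ).eventually (gt_mem_nhds hp.1)).exists
  obtain ⟨b, hb⟩ := ((tendsto_cdf_atTop ρ).eventually (lt_mem_nhds hp.2)).exists
  exact mem_range_of_exists_le_of_exists_ge h.continuous ⟨a, ha.le⟩ ⟨b, hb.le⟩

lemma quantile_cdf (h : RegularCDF ρ) (t : ℝ) : quantile ρ (cdf ρ t) = t := by
  have : {y | cdf ρ t ≤ cdf ρ y} = Ici t := by ext y; exact h.strictMono.le_iff_le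
  rw [quantile, this, csInf_Ici]

lemma cdf_quantile (h : RegularCDF ρ) {p : ℝ} (hp : p ∈ Ioo (0 : ℝ) 1) :
    cdf ρ (quantile ρ p) = p := by
  obtain ⟨t, rfl⟩ := h.exists_cdf_eq hp
  rw [h.quantile_cdf]

lemma continuousAt_quantile (h : RegularCDF ρ) {p : ℝ} (hp : p ∈ Ioo (0 : ℝ) 1) :
    ContinuousAt (quantile ρ) p := by
  refine continuousAt_of_monotoneOn_of_image_mem_nhds (s := Ioo 0 1) ?_ (Ioo_mem_nhds hp.1 hp.2) ?_
  · intro q hq r hr hqr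
    rwa [← h.strictMono.le_iff_le, h.cdf_quantile hq, h.cdf_quantile hr]
  · convert univ_mem
    exact eq_univ_of_forall fun y => ⟨cdf ρ y, h.cdf_mem_Ioo y, h.quantile_cdf y⟩

lemma differentiableAt_quantile (h : RegularCDF ρ) {p : ℝ} (hp : p ∈ Ioo (0 : ℝ) 1) :
    DifferentiableAt ℝ (quantile ρ) p := by
  obtain ⟨d, hd, hderiv⟩ := h (quantile ρ p)
  refine (HasDerivAt.of_local_left_inverse (h.continuousAt_quantile hp) hderiv hd.ne'
    ?_).differentiableAt
  filter_upwards [Ioo_mem_nhds hp.1 hp.2] with q hq using h.cdf_quantile hq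

lemma cdf_monoMap (hρ : RegularCDF ρ) (hη : RegularCDF η) (t : ℝ) :
    cdf η (monoMap ρ η t) = cdf ρ t :=
  hη.cdf_quantile (hρ.cdf_mem_Ioo t)

lemma monoMap_monoMap (hρ : RegularCDF ρ) (hη : RegularCDF η) (t : ℝ) :
    monoMap η ρ (monoMap ρ η t) = t := by
  rw [monoMap, hρ.cdf_monoMap hη, hρ.quantile_cdf]

/-- The monotone rearrangement of `ρ` onto `η`, as an order isomorphism of the line. -/
noncomputable def monoIso (hρ : RegularCDF ρ) (hη : RegularCDF η) : ℝ ≃o ℝ where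
  toFun := monoMap ρ η
  invFun := monoMap η ρ
  left_inv := hρ.monoMap_monoMap hη
  right_inv := hη.monoMap_monoMap hρ
  map_rel_iff' {s t} := by
    rw [Equiv.coe_fn_mk, ← hη.strictMono.le_iff_le, hρ.cdf_monoMap hη, hρ.cdf_monoMap hη,
      hρ.strictMono.le_iff_le]

lemma monotone_monoMap (hρ : RegularCDF ρ) (hη : RegularCDF η) : Monotone (monoMap ρ η) :=
  (hρ.monoIso hη).monotone

lemma continuous_monoMap (hρ : RegularCDF ρ) (hη : RegularCDF η) : Continuous (monoMap ρ η) :=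
  (hρ.monoIso hη).continuous

lemma differentiable_monoMap (hρ : RegularCDF ρ) (hη : RegularCDF η) :
    Differentiable ℝ (monoMap ρ η) := fun t =>
  (hη.differentiableAt_quantile (hρ.cdf_mem_Ioo t)).comp t (hρ.differentiable t)

lemma map_monoMap [IsProbabilityMeasure ρ] [IsProbabilityMeasure η]
    (hρ : RegularCDF ρ) (hη : RegularCDF η) : ρ.map (monoMap ρ η) = η := by
  have hm := (hρ.continuous_monoMap hη).measurable
  have := Measure.isProbabilityMeasure_map (μ := ρ) hm.aemeasurable
  refine Measure.eq_of_cdf _ _ (StieltjesFunction.ext fun y => ?_)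
  have preimage : monoMap ρ η ⁻¹' Iic y = Iic (monoMap η ρ y) := by
    ext t; exact ((hρ.monoIso hη).le_symm_apply (x := t) (y := y)).symm
  rw [cdf_eq_real, map_measureReal_apply hm measurableSet_Iic, preimage, ← cdf_eq_real,
    hη.cdf_monoMap hρ]

lemma tendsto_of_tendsto_cdf {ι : Type*} {l : Filter ι} {ηs : ι → Measure ℝ}
    (hηs : ∀ i, RegularCDF (ηs i)) (hη : RegularCDF η) {ys : ι → ℝ} {y : ℝ}
    (hcdf : ∀ x, Tendsto (fun i => cdf (ηs i) x) l (𝓝 (cdf η x)))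
    (hy : Tendsto (fun i => cdf (ηs i) (ys i)) l (𝓝 (cdf η y))) : Tendsto ys l (𝓝 y) := by
  refine tendsto_order.2 ⟨fun a ha => ?_, fun a ha => ?_⟩
  · filter_upwards [(hcdf a).eventually_lt hy (hη.strictMono ha)] with i hi
    exact (hηs i).strictMono.lt_iff_lt.1 hi
  · filter_upwards [hy.eventually_lt (hcdf a) (hη.strictMono ha)] with i hi
    exact (hηs i).strictMono.lt_iff_lt.1 hi

lemma tendsto_monoMap {ι : Type*} {l : Filter ι} {ρs ηs : ι → Measure ℝ}
    (hρs : ∀ i, RegularCDF (ρs i)) (hηs : ∀ i, RegularCDF (ηs i)) (hρ : RegularCDF ρ)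
    (hη : RegularCDF η) {ts : ι → ℝ} {t : ℝ}
    (hcdfη : ∀ x, Tendsto (fun i => cdf (ηs i) x) l (𝓝 (cdf η x)))
    (hcdfρ : Tendsto (fun i => cdf (ρs i) (ts i)) l (𝓝 (cdf ρ t))) :
    Tendsto (fun i => monoMap (ρs i) (ηs i) (ts i)) l (𝓝 (monoMap ρ η t)) := by
  refine hη.tendsto_of_tendsto_cdf hηs hcdfη ?_
  rw [hρ.cdf_monoMap hη]
  simpa only [fun i => (hρs i).cdf_monoMap (hηs i) (ts i)] using hcdfρ

lemma sq_monoMap_mul_le [IsProbabilityMeasure η] (hρ : RegularCDF ρ) (hη : RegularCDF η)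
    (h2 : Integrable (fun y => y ^ 2) η) {c t : ℝ} (hc : c ≤ cdf ρ t) (hc' : c ≤ 1 - cdf ρ t) :
    monoMap ρ η t ^ 2 * c ≤ ∫ y, y ^ 2 ∂η :=
  sq_mul_le_integral_sq_of_le_cdf h2 (by rwa [hρ.cdf_monoMap hη]) (by rwa [hρ.cdf_monoMap hη])

end RegularCDF

/-! ### Quadratic transport cost -/

section Cost

variable {F : Type*} [MeasurableSpace F] {μ ν : Measure F} {π : Measure (F × F)}

lemma measurePreserving_fst_of_mem_couplings (hπ : π ∈ couplings μ ν) :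
    MeasurePreserving Prod.fst π μ :=
  ⟨measurable_fst, hπ.2.1⟩

lemma measurePreserving_snd_of_mem_couplings (hπ : π ∈ couplings μ ν) :
    MeasurePreserving Prod.snd π ν :=
  ⟨measurable_snd, hπ.2.2⟩

lemma map_prodMk_mem_couplings {Ω : Type*} [MeasurableSpace Ω] {P : Measure Ω}
    [IsProbabilityMeasure P] {U V : Ω → F} (hU : AEMeasurable U P) (hV : AEMeasurable V P) :
    P.map (fun ω => (U ω, V ω)) ∈ couplings (P.map U) (P.map V) := by
  have hUV := hU.prodMk hV
  refine ⟨Measure.isProbabilityMeasure_map hUV, ?_, ?_⟩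
  · exact AEMeasurable.map_map_of_aemeasurable measurable_fst.aemeasurable hUV
  · exact AEMeasurable.map_map_of_aemeasurable measurable_snd.aemeasurable hUV

variable [NormedAddCommGroup F]

lemma memLp_sub_of_mem_couplings (hμ : MemLp id 2 μ) (hν : MemLp id 2 ν)
    (hπ : π ∈ couplings μ ν) : MemLp (fun p : F × F => p.1 - p.2) 2 π :=
  (hμ.comp_measurePreserving (measurePreserving_fst_of_mem_couplings hπ)).sub
    (hν.comp_measurePreserving (measurePreserving_snd_of_mem_couplings hπ))

lemma lintegral_cost_eq (hμ : MemLp id 2 μ) (hν : MemLp id 2 ν) (hπ : π ∈ couplings μ ν) :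
    ∫⁻ p, ENNReal.ofReal (‖p.1 - p.2‖ ^ 2 / 2) ∂π =
      ENNReal.ofReal (∫ p, ‖p.1 - p.2‖ ^ 2 / 2 ∂π) :=
  have := hπ.1
  (ofReal_integral_eq_lintegral_ofReal
    (((memLp_sub_of_mem_couplings hμ hν hπ).integrable_norm_pow two_ne_zero).div_const 2)
      (ae_of_all _ fun p => by positivity)).symm

lemma W2sq_le_integral (hμ : MemLp id 2 μ) (hν : MemLp id 2 ν) (hπ : π ∈ couplings μ ν) :
    W2sq μ ν ≤ ∫ p, ‖p.1 - p.2‖ ^ 2 / 2 ∂π := by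
  rw [W2sq, ← ENNReal.toReal_ofReal (integral_nonneg fun p => by positivity :
    0 ≤ ∫ p, ‖p.1 - p.2‖ ^ 2 / 2 ∂π), ← lintegral_cost_eq hμ hν hπ]
  refine ENNReal.toReal_mono ?_ (iInf₂_le π hπ)
  rw [lintegral_cost_eq hμ hν hπ]
  exact ENNReal.ofReal_ne_top

lemma W2sq_map_le [BorelSpace F] [SecondCountableTopology F] {Ω : Type*}
    [MeasurableSpace Ω] {P : Measure Ω} [IsProbabilityMeasure P] {U V : Ω → F} (hU : MemLp U 2 P)
    (hV : MemLp V 2 P) :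
    W2sq (P.map U) (P.map V) ≤ ∫ ω, ‖U ω - V ω‖ ^ 2 / 2 ∂P := by
  have hUm := hU.aestronglyMeasurable.aemeasurable
  have hVm := hV.aestronglyMeasurable.aemeasurable
  have hc : Continuous fun p : F × F => ‖p.1 - p.2‖ ^ 2 / 2 := by fun_prop
  rw [← integral_map (hUm.prodMk hVm) hc.aestronglyMeasurable]
  exact W2sq_le_integral ((memLp_map_measure_iff aestronglyMeasurable_id hUm).2 hU)
    ((memLp_map_measure_iff aestronglyMeasurable_id hVm).2 hV) (map_prodMk_mem_couplings hUm hVm)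

variable [IsProbabilityMeasure μ] [IsProbabilityMeasure ν]

lemma iInf_cost_ne_top (hμ : MemLp id 2 μ) (hν : MemLp id 2 ν) :
    (⨅ π ∈ couplings μ ν, ∫⁻ p, ENNReal.ofReal (‖p.1 - p.2‖ ^ 2 / 2) ∂π) ≠ ⊤ := by
  have hprod : μ.prod ν ∈ couplings μ ν := ⟨inferInstance, by simp, by simp⟩
  exact ne_top_of_le_ne_top
    (by rw [lintegral_cost_eq hμ hν hprod]; exact ENNReal.ofReal_ne_top) (iInf₂_le _ hprod)

lemma exists_coupling_lt (hμ : MemLp id 2 μ) (hν : MemLp id 2 ν) {c : ℝ} (h : W2sq μ ν < c) :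
    ∃ π ∈ couplings μ ν, ∫ p, ‖p.1 - p.2‖ ^ 2 ∂π < 2 * c := by
  have hc : 0 < c := ENNReal.toReal_nonneg.trans_lt h
  rw [W2sq, ← ENNReal.lt_ofReal_iff_toReal_lt (iInf_cost_ne_top hμ hν)] at h
  simp only [iInf_lt_iff] at h
  obtain ⟨π, hπ, hlt⟩ := h
  refine ⟨π, hπ, ?_⟩
  rw [lintegral_cost_eq hμ hν hπ, ENNReal.ofReal_lt_ofReal_iff hc, integral_div] at hlt
  linarith

/-- The easy half of Kantorovich duality. -/
lemma integral_add_integral_le_W2sq (hμ : MemLp id 2 μ) (hν : MemLp id 2 ν) {α β : F → ℝ}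
    (hα : Integrable α μ) (hβ : Integrable β ν) (hαβ : ∀ x y, α x + β y ≤ ‖x - y‖ ^ 2 / 2) :
    ∫ x, α x ∂μ + ∫ y, β y ∂ν ≤ W2sq μ ν := by
  rw [W2sq, ← ENNReal.ofReal_le_iff_le_toReal (iInf_cost_ne_top hμ hν)]
  refine le_iInf₂ fun π hπ => ?_
  have hfst := measurePreserving_fst_of_mem_couplings hπ
  have hsnd := measurePreserving_snd_of_mem_couplings hπ
  have hα' : Integrable (fun p : F × F => α p.1) π := hfst.integrable_comp_of_integrable hα
  have hβ' : Integrable (fun p : F × F => β p.2) π := hsnd.integrable_comp_of_integrable hβ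
  have := hπ.1
  rw [lintegral_cost_eq hμ hν hπ]
  refine ENNReal.ofReal_le_ofReal ?_
  calc ∫ x, α x ∂μ + ∫ y, β y ∂ν
      = ∫ p, (α p.1 + β p.2) ∂π := by
        rw [integral_add hα' hβ', ← integral_map hfst.aemeasurable (hfst.map_eq ▸ hα.1),
          ← integral_map hsnd.aemeasurable (hsnd.map_eq ▸ hβ.1), hfst.map_eq, hsnd.map_eq]
    _ ≤ ∫ p, ‖p.1 - p.2‖ ^ 2 / 2 ∂π := integral_mono (hα'.add hβ')
        (((memLp_sub_of_mem_couplings hμ hν hπ).integrable_norm_pow two_ne_zero).div_const 2)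
        fun p => hαβ p.1 p.2

end Cost

/-! ### Optimality of monotone maps -/

section Monotone

variable {T : ℝ → ℝ}

lemma mul_sub_le_integral_of_monotone (hT : Monotone T) (s x : ℝ) :
    T s * (x - s) ≤ (∫ r in (0 : ℝ)..x, T r) - ∫ r in (0 : ℝ)..s, T r := by
  have hi : ∀ a b, IntervalIntegrable T volume a b := fun a b => hT.intervalIntegrable
  rw [intervalIntegral.integral_interval_sub_left (hi _ _) (hi _ _)]
  rcases le_total s x with h | h
  · have := intervalIntegral.integral_mono_on (μ := volume) h intervalIntegrable_const (hi s x)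
      fun r hr => hT hr.1
    simpa only [intervalIntegral.integral_const, smul_eq_mul, mul_comm] using this
  · have := intervalIntegral.integral_mono_on (μ := volume) h (hi x s) intervalIntegrable_const
      fun r hr => hT hr.2
    rw [intervalIntegral.integral_const, smul_eq_mul] at this
    rw [intervalIntegral.integral_symm]
    linarith

lemma integrable_primitive_of_monotone {ρ : Measure ℝ} [IsFiniteMeasure ρ] (hT : Monotone T)
    (h2 : MemLp id 2 ρ) (h2T : MemLp T 2 ρ) : Integrable (fun x => ∫ r in (0 : ℝ)..x, T r) ρ := by
  have hmajorant : Integrable (fun x => |x| * |T x| + |T 0| * |x|) ρ :=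
    (MemLp.integrable_mul h2.norm h2T.norm).add
      ((h2.integrable one_le_two).norm.const_mul |T 0|)
  have hcont : Continuous fun x => ∫ r in (0 : ℝ)..x, T r :=
    intervalIntegral.continuous_primitive (fun _ _ => hT.intervalIntegrable) 0
  refine hmajorant.mono' hcont.aestronglyMeasurable (ae_of_all _ fun x => ?_)
  have lower := mul_sub_le_integral_of_monotone hT 0 x
  have upper := mul_sub_le_integral_of_monotone hT x 0
  rw [intervalIntegral.integral_same] at lower upper
  rw [Real.norm_eq_abs, abs_le, ← abs_mul, ← abs_mul]
  constructor
  · linarith [neg_abs_le (T 0 * x), abs_nonneg (x * T x)]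
  · linarith [le_abs_self (x * T x), abs_nonneg (T 0 * x)]

lemma W2sq_map_orderIso {ρ : Measure ℝ} [IsProbabilityMeasure ρ] (e : ℝ ≃o ℝ)
    (h2 : MemLp id 2 ρ) (h2e : MemLp e 2 ρ) :
    W2sq ρ (ρ.map e) = ∫ t, (t - e t) ^ 2 / 2 ∂ρ := by
  have hem : AEMeasurable e ρ := e.continuous.measurable.aemeasurable
  refine le_antisymm ?_ ?_
  · simpa only [Measure.map_id, id_eq, Real.norm_eq_abs, sq_abs] using W2sq_map_le h2 h2e
  have := Measure.isProbabilityMeasure_map hem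
  -- The dual potentials are `x²/2 - φ` and `y²/2 - φ*`, with `φ` a primitive of `e` and
  -- `φ* y = y e⁻¹(y) - φ (e⁻¹ y)` its Legendre transform.
  set φ : ℝ → ℝ := fun x => ∫ r in (0 : ℝ)..x, e r
  set β : ℝ → ℝ := fun y => y ^ 2 / 2 - (y * e.symm y - φ (e.symm y))
  have hφ : Continuous φ :=
    intervalIntegral.continuous_primitive (fun _ _ => e.continuous.intervalIntegrable _ _) 0
  have hφi : Integrable φ ρ := integrable_primitive_of_monotone e.monotone h2 h2e
  have hα : Integrable (fun x => x ^ 2 / 2 - φ x) ρ := (h2.integrable_sq.div_const 2).sub hφi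
  have hβc : Continuous β := by have := e.symm.continuous; fun_prop
  have hβe : Integrable (fun x => β (e x)) ρ := by
    simp only [β, e.symm_apply_apply]
    exact (h2e.integrable_sq.div_const 2).sub ((MemLp.integrable_mul h2e h2).sub hφi)
  calc ∫ t, (t - e t) ^ 2 / 2 ∂ρ
      = ∫ x, (x ^ 2 / 2 - φ x) ∂ρ + ∫ y, β y ∂(ρ.map e) := by
        rw [integral_map hem hβc.aestronglyMeasurable, ← integral_add hα hβe]
        refine integral_congr_ae (ae_of_all _ fun x => ?_)
        simp only [β, e.symm_apply_apply]
        ring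
    _ ≤ W2sq ρ (ρ.map e) := by
        refine integral_add_integral_le_W2sq h2
          ((memLp_map_measure_iff aestronglyMeasurable_id hem).2 h2e) hα
          ((integrable_map_measure hβc.aestronglyMeasurable hem).2 hβe) fun x y => ?_
        have := mul_sub_le_integral_of_monotone e.monotone (e.symm y) x
        rw [e.apply_symm_apply] at this
        simp only [β, Real.norm_eq_abs, sq_abs]
        linarith [this, sq_nonneg (x - y)]

end Monotone

lemma RegularCDF.W2sq_eq {ρ η : Measure ℝ} [IsProbabilityMeasure ρ] [IsProbabilityMeasure η]
    (hρ : RegularCDF ρ) (hη : RegularCDF η) (h2ρ : MemLp id 2 ρ) (h2η : MemLp id 2 η) :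
    W2sq ρ η = ∫ t, (t - monoMap ρ η t) ^ 2 / 2 ∂ρ := by
  have hmap : ρ.map (hρ.monoIso hη) = η := hρ.map_monoMap hη
  have h2T : MemLp (hρ.monoIso hη) 2 ρ :=
    h2η.comp_measurePreserving ⟨(hρ.monoIso hη).continuous.measurable, hmap⟩
  have := W2sq_map_orderIso (hρ.monoIso hη) h2ρ h2T
  rwa [hmap] at this

/-! ### Gaussian smoothing on the line -/

section GaussianDensity

variable {v : ℝ≥0}

lemma continuous_gaussianPDFReal (μ : ℝ) (v : ℝ≥0) : Continuous (gaussianPDFReal μ v) := by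
  rw [gaussianPDFReal_def]; fun_prop

lemma gaussianPDFReal_le (μ : ℝ) (v : ℝ≥0) (t : ℝ) :
    gaussianPDFReal μ v t ≤ (√(2 * Real.pi * v))⁻¹ := by
  refine mul_le_of_le_one_right (by positivity) (Real.exp_le_one_iff.2 ?_)
  rw [neg_div]
  exact neg_nonpos.2 (by positivity)

lemma norm_gaussianPDFReal_le (μ : ℝ) (v : ℝ≥0) (t : ℝ) :
    ‖gaussianPDFReal μ v t‖ ≤ (√(2 * Real.pi * v))⁻¹ :=
  (Real.norm_of_nonneg (gaussianPDFReal_nonneg μ v t)).trans_le (gaussianPDFReal_le μ v t)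

lemma gaussianPDFReal_zero_apply (v : ℝ≥0) (t : ℝ) :
    gaussianPDFReal 0 v t = (√(2 * Real.pi * v))⁻¹ * Real.exp (-t ^ 2 / (2 * v)) := by
  rw [gaussianPDFReal, sub_zero]

lemma inv_gaussianPDFReal_zero (v : ℝ≥0) (t : ℝ) :
    (gaussianPDFReal 0 v t)⁻¹ = √(2 * Real.pi * v) * Real.exp (t ^ 2 / (2 * v)) := by
  rw [gaussianPDFReal_zero_apply, mul_inv, inv_inv, ← Real.exp_neg, neg_div, neg_neg]

lemma gaussianPDFReal_zero_le_of_abs_le (v : ℝ≥0) {s t : ℝ} (h : |s| ≤ t) :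
    gaussianPDFReal 0 v t ≤ gaussianPDFReal 0 v s := by
  rw [gaussianPDFReal_zero_apply, gaussianPDFReal_zero_apply]
  have : s ^ 2 ≤ t ^ 2 := sq_le_sq.2 (h.trans (le_abs_self t))
  gcongr

lemma hasDerivAt_gaussianPDFReal_zero (v : ℝ≥0) (t : ℝ) :
    HasDerivAt (gaussianPDFReal 0 v) (-(t / v) * gaussianPDFReal 0 v t) t := by
  have hexponent : HasDerivAt (fun t : ℝ => -t ^ 2 / (2 * v)) (-(t / v)) t := by
    refine ((hasDerivAt_pow 2 t).neg.div_const (2 * (v : ℝ))).congr_deriv ?_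
    rw [Nat.cast_two, pow_one, neg_div, mul_div_mul_left _ _ two_ne_zero]
  rw [funext (gaussianPDFReal_zero_apply v)]
  exact (hexponent.exp.const_mul _).congr_deriv (by ring)

lemma cdf_gaussianReal_eq_setIntegral (μ : ℝ) (hv : v ≠ 0) (t : ℝ) :
    cdf (gaussianReal μ v) t = ∫ x in Iic t, gaussianPDFReal μ v x := by
  rw [cdf_eq_real, measureReal_def, gaussianReal_apply_eq_integral μ hv,
    ENNReal.toReal_ofReal (integral_nonneg fun x => gaussianPDFReal_nonneg μ v x)]

lemma hasDerivAt_cdf_gaussianReal (μ : ℝ) (hv : v ≠ 0) (t : ℝ) :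
    HasDerivAt (cdf (gaussianReal μ v)) (gaussianPDFReal μ v t) t := by
  have hi (s : Set ℝ) : IntegrableOn (gaussianPDFReal μ v) s :=
    (integrable_gaussianPDFReal μ v).integrableOn
  have hcdf : (cdf (gaussianReal μ v) : ℝ → ℝ) =
      fun t => (∫ x in (0 : ℝ)..t, gaussianPDFReal μ v x) + cdf (gaussianReal μ v) 0 := by
    ext t
    rw [cdf_gaussianReal_eq_setIntegral μ hv, cdf_gaussianReal_eq_setIntegral μ hv,
      ← intervalIntegral.integral_Iic_sub_Iic (hi _) (hi _), sub_add_cancel]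
  rw [hcdf]
  have hc := continuous_gaussianPDFReal μ v
  exact (intervalIntegral.integral_hasDerivAt_right (hc.intervalIntegrable _ _)
    (hc.stronglyMeasurableAtFilter _ _) hc.continuousAt).add_const _

lemma continuous_cdf_gaussianReal (μ : ℝ) (hv : v ≠ 0) : Continuous (cdf (gaussianReal μ v)) :=
  continuous_iff_continuousAt.2 fun t => (hasDerivAt_cdf_gaussianReal μ hv t).continuousAt

lemma abs_cdf_gaussianReal_sub_le (μ : ℝ) (hv : v ≠ 0) (a b : ℝ) :
    |cdf (gaussianReal μ v) a - cdf (gaussianReal μ v) b| ≤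
      (√(2 * Real.pi * v))⁻¹ * |a - b| :=
  Convex.norm_image_sub_le_of_norm_hasDerivWithin_le
    (fun x _ => (hasDerivAt_cdf_gaussianReal μ hv x).hasDerivWithinAt)
    (fun x _ => norm_gaussianPDFReal_le μ v x) convex_univ (mem_univ b) (mem_univ a)

lemma gaussianPDFReal_zero_le_cdf_sub (hv : v ≠ 0) {a x : ℝ} (hx : |x| ≤ a) (hx' : |x + 1| ≤ a) :
    gaussianPDFReal 0 v a ≤ cdf (gaussianReal 0 v) (x + 1) - cdf (gaussianReal 0 v) x := by
  obtain ⟨ξ, hξ, hslope⟩ := exists_hasDerivAt_eq_slope (cdf (gaussianReal 0 v))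
    (gaussianPDFReal 0 v) (lt_add_one x) (continuous_cdf_gaussianReal 0 hv).continuousOn
    fun y _ => hasDerivAt_cdf_gaussianReal 0 hv y
  rw [add_sub_cancel_left, div_one] at hslope
  rw [← hslope]
  exact gaussianPDFReal_zero_le_of_abs_le v
    (abs_le.2 ⟨(abs_le.1 hx).1.trans hξ.1.le, hξ.2.le.trans (abs_le.1 hx').2⟩)

lemma gaussianPDFReal_zero_le_cdf (hv : v ≠ 0) {a x : ℝ} (h : |x| ≤ a) :
    gaussianPDFReal 0 v (a + 1) ≤ cdf (gaussianReal 0 v) x := by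
  have := gaussianPDFReal_zero_le_cdf_sub hv (a := a + 1) (x := x - 1)
    (by linarith [abs_sub x 1, abs_one (α := ℝ)]) (by rw [sub_add_cancel]; linarith)
  rw [sub_add_cancel] at this
  linarith [cdf_nonneg (gaussianReal 0 v) (x - 1)]

lemma gaussianPDFReal_zero_le_one_sub_cdf (hv : v ≠ 0) {a x : ℝ} (h : |x| ≤ a) :
    gaussianPDFReal 0 v (a + 1) ≤ 1 - cdf (gaussianReal 0 v) x := by
  have := gaussianPDFReal_zero_le_cdf_sub hv (a := a + 1) (x := x)
    (by linarith) (by linarith [abs_add_le x 1, abs_one (α := ℝ)])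
  linarith [cdf_le_one (gaussianReal 0 v) (x + 1)]

end GaussianDensity

section Smoothing

lemma integrable_cdf_comp {α : Type*} [MeasurableSpace α] {π : Measure α} [IsFiniteMeasure π]
    (γ : Measure ℝ) {f : α → ℝ} (hf : Measurable f) : Integrable (fun a => cdf γ (f a)) π := by
  refine Integrable.of_bound (C := 1) ((monotone_cdf γ).measurable.comp hf).aestronglyMeasurable
    (ae_of_all _ fun a => ?_)
  rw [Real.norm_of_nonneg (cdf_nonneg _ _)]
  exact cdf_le_one _ _

variable {m : Measure ℝ} [IsProbabilityMeasure m]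

lemma cdf_conv (γ : Measure ℝ) [IsProbabilityMeasure γ] (t : ℝ) :
    cdf (m.conv γ) t = ∫ y, cdf γ (t - y) ∂m := by
  have hadd : Measurable fun x : ℝ × ℝ => x.1 + x.2 := by fun_prop
  have hsection (y : ℝ) :
      Prod.mk y ⁻¹' ((fun x : ℝ × ℝ => x.1 + x.2) ⁻¹' Iic t) = Iic (t - y) := by
    ext z
    simp only [mem_preimage, mem_Iic, le_sub_iff_add_le']
  rw [cdf_eq_real, measureReal_def, Measure.conv, Measure.map_apply hadd measurableSet_Iic,
    Measure.prod_apply (hadd measurableSet_Iic),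
    integral_eq_lintegral_of_nonneg_ae (ae_of_all _ fun y => cdf_nonneg _ _)
      (integrable_cdf_comp γ (by fun_prop)).aestronglyMeasurable]
  simp only [hsection, ofReal_cdf]

variable {v : ℝ≥0}

lemma integrable_gaussianPDFReal_sub (v : ℝ≥0) (t : ℝ) :
    Integrable (fun y => gaussianPDFReal 0 v (t - y)) m := by
  have := continuous_gaussianPDFReal 0 v
  exact Integrable.of_bound (C := (√(2 * Real.pi * v))⁻¹) (by fun_prop)
    (ae_of_all _ fun y => norm_gaussianPDFReal_le 0 v _)

lemma hasDerivAt_cdf_conv_gaussianReal (hv : v ≠ 0) (t : ℝ) :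
    HasDerivAt (cdf (m.conv (gaussianReal 0 v))) (∫ y, gaussianPDFReal 0 v (t - y) ∂m) t := by
  rw [funext (cdf_conv (m := m) (gaussianReal 0 v))]
  refine (hasDerivAt_integral_of_dominated_loc_of_deriv_le univ_mem
    (Eventually.of_forall fun x => (integrable_cdf_comp _ (by fun_prop)).aestronglyMeasurable)
    (integrable_cdf_comp _ (by fun_prop)) (integrable_gaussianPDFReal_sub v t).aestronglyMeasurable
    (ae_of_all _ fun y x _ => norm_gaussianPDFReal_le 0 v (x - y)) (integrable_const _)
    (ae_of_all _ fun y x _ => ?_)).2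
  exact (hasDerivAt_cdf_gaussianReal 0 hv (x - y)).comp_sub_const x y

lemma regularCDF_conv_gaussianReal (hv : v ≠ 0) : RegularCDF (m.conv (gaussianReal 0 v)) := by
  refine fun t => ⟨_, ?_, hasDerivAt_cdf_conv_gaussianReal hv t⟩
  have hsupport : Function.support (fun y => gaussianPDFReal 0 v (t - y)) = univ :=
    eq_univ_of_forall fun y => (gaussianPDFReal_pos 0 v _ hv).ne'
  rw [integral_pos_iff_support_of_nonneg (fun y => gaussianPDFReal_nonneg _ _ _)
    (integrable_gaussianPDFReal_sub v t), hsupport, measure_univ]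
  exact one_pos

end Smoothing

/-! ### Growth of the rearrangement of a smoothed measure -/

section Growth

variable {v : ℝ≥0} {m : Measure ℝ} [IsProbabilityMeasure m]

/-- Growth at most that of `exp (t² / 3v)`. The rate lies strictly between `1 / 4v`, which appears
when the tails of a Gaussian of variance `v` are inverted in a second moment bound, and `1 / 2v`,
the decay rate of the density of that Gaussian. -/
def HasGaussianGrowth (v : ℝ≥0) (K : ℝ) (g : ℝ → ℝ) : Prop :=
  ∀ t, |g t| ≤ K * Real.exp (t ^ 2 / (3 * v))

lemma half_le_measureReal_abs_le (h2 : Integrable (fun y => y ^ 2) m) {R : ℝ} (hR : 0 < R)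
    (hmR : 2 * ∫ y, y ^ 2 ∂m ≤ R ^ 2) : 1 / 2 ≤ m.real {y | |y| ≤ R} := by
  have markov : R ^ 2 * m.real {y | R ^ 2 ≤ y ^ 2} ≤ ∫ y, y ^ 2 ∂m :=
    mul_meas_ge_le_integral_of_nonneg (ae_of_all _ fun y => sq_nonneg y) h2 _
  have htail : m.real {y | R ^ 2 ≤ y ^ 2} ≤ 1 / 2 := by
    refine le_of_mul_le_mul_left ?_ (pow_pos hR 2)
    linarith
  have hcompl : {y : ℝ | R ^ 2 ≤ y ^ 2}ᶜ ⊆ {y | |y| ≤ R} := fun y hy =>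
    abs_le_of_sq_le_sq (not_le.1 (show ¬R ^ 2 ≤ y ^ 2 from hy)).le hR.le
  have hmeas : MeasurableSet {y : ℝ | R ^ 2 ≤ y ^ 2} :=
    measurableSet_le measurable_const (by fun_prop)
  calc (1 : ℝ) / 2 ≤ m.real {y | R ^ 2 ≤ y ^ 2}ᶜ := by
        rw [probReal_compl_eq_one_sub hmeas]; linarith
    _ ≤ m.real {y | |y| ≤ R} := measureReal_mono hcompl

lemma half_le_integral_of_le (h2 : Integrable (fun y => y ^ 2) m) {R : ℝ} (hR : 0 < R)
    (hmR : 2 * ∫ y, y ^ 2 ∂m ≤ R ^ 2) {f : ℝ → ℝ} (hf : Integrable f m) (hf0 : ∀ y, 0 ≤ f y)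
    {c : ℝ} (hc : 0 ≤ c) (hcf : ∀ y, |y| ≤ R → c ≤ f y) : c / 2 ≤ ∫ y, f y ∂m :=
  calc c / 2 = c * (1 / 2) := by ring
    _ ≤ c * m.real {y | c ≤ f y} := by
        refine mul_le_mul_of_nonneg_left ?_ hc
        exact (half_le_measureReal_abs_le h2 hR hmR).trans (measureReal_mono hcf)
    _ ≤ ∫ y, f y ∂m := mul_meas_ge_le_integral_of_nonneg (ae_of_all _ hf0) hf _

lemma half_gaussianPDFReal_le_cdf_conv (hv : v ≠ 0) (h2 : Integrable (fun y => y ^ 2) m) {R : ℝ}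
    (hR : 0 < R) (hmR : 2 * ∫ y, y ^ 2 ∂m ≤ R ^ 2) (t : ℝ) :
    gaussianPDFReal 0 v (|t| + R + 1) / 2 ≤ cdf (m.conv (gaussianReal 0 v)) t := by
  rw [cdf_conv]
  exact half_le_integral_of_le h2 hR hmR (integrable_cdf_comp _ (by fun_prop))
    (fun y => cdf_nonneg _ _) (gaussianPDFReal_nonneg _ _ _) fun y hy =>
      gaussianPDFReal_zero_le_cdf hv (by linarith [abs_sub t y])

lemma half_gaussianPDFReal_le_one_sub_cdf_conv (hv : v ≠ 0)
    (h2 : Integrable (fun y => y ^ 2) m) {R : ℝ} (hR : 0 < R) (hmR : 2 * ∫ y, y ^ 2 ∂m ≤ R ^ 2)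
    (t : ℝ) :
    gaussianPDFReal 0 v (|t| + R + 1) / 2 ≤ 1 - cdf (m.conv (gaussianReal 0 v)) t := by
  have hi : Integrable (fun y => cdf (gaussianReal 0 v) (t - y)) m :=
    integrable_cdf_comp _ (by fun_prop)
  have hcompl : 1 - cdf (m.conv (gaussianReal 0 v)) t =
      ∫ y, (1 - cdf (gaussianReal 0 v) (t - y)) ∂m := by
    rw [integral_sub (integrable_const 1) hi, integral_const, probReal_univ, one_smul, cdf_conv]
  rw [hcompl]
  exact half_le_integral_of_le h2 hR hmR ((integrable_const 1).sub hi)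
    (fun y => sub_nonneg.2 (cdf_le_one _ _)) (gaussianPDFReal_nonneg _ _ _) fun y hy =>
      gaussianPDFReal_zero_le_one_sub_cdf hv (by linarith [abs_sub t y])

/-- The constant in the growth bound for the rearrangement of a smoothed measure, in terms of the
variance `v` of the smoothing, of a bound `M` for the second moment of the target and of a radius
`R` within which half of the mass of the unsmoothed measure lies. -/
noncomputable def growthConst (v : ℝ≥0) (M R : ℝ) : ℝ :=
  √(2 * M * √(2 * Real.pi * v) * Real.exp (2 * (R + 1) ^ 2 / v))

lemma add_sq_div_two_mul_le (v : ℝ≥0) (t r : ℝ) :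
    (|t| + r) ^ 2 / (2 * v) ≤ 2 * r ^ 2 / v + 2 * (t ^ 2 / (3 * v)) := by
  have hsplit : 2 * r ^ 2 / v + 2 * (t ^ 2 / (3 * v)) = (4 * r ^ 2 + 4 / 3 * t ^ 2) / (2 * v) := by
    ring
  rw [hsplit, ← sq_abs t]
  gcongr
  linarith [sq_nonneg (|t| - 3 * r)]

lemma hasGaussianGrowth_monoMap (hv : v ≠ 0) (h2 : Integrable (fun y => y ^ 2) m) {R : ℝ}
    (hR : 0 < R) (hmR : 2 * ∫ y, y ^ 2 ∂m ≤ R ^ 2) {η : Measure ℝ} [IsProbabilityMeasure η]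
    (hη : RegularCDF η) (h2η : Integrable (fun y => y ^ 2) η) {M : ℝ} (hM : ∫ y, y ^ 2 ∂η ≤ M) :
    HasGaussianGrowth v (growthConst v M R) (monoMap (m.conv (gaussianReal 0 v)) η) := by
  intro t
  set T := monoMap (m.conv (gaussianReal 0 v)) η t
  set p := gaussianPDFReal 0 v (|t| + R + 1)
  have hp : 0 < p := gaussianPDFReal_pos 0 v _ hv
  have hM0 : 0 ≤ M := (integral_nonneg fun y => sq_nonneg y).trans hM
  have hT : T ^ 2 * (p / 2) ≤ M :=
    ((regularCDF_conv_gaussianReal hv).sq_monoMap_mul_le hη h2η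
      (half_gaussianPDFReal_le_cdf_conv hv h2 hR hmR t)
      (half_gaussianPDFReal_le_one_sub_cdf_conv hv h2 hR hmR t)).trans hM
  rw [growthConst]
  refine abs_le_of_sq_le_sq ?_ (by positivity)
  rw [mul_pow, Real.sq_sqrt (by positivity), ← Real.exp_nat_mul, mul_assoc, ← Real.exp_add]
  calc T ^ 2 = T ^ 2 * (p / 2) * (2 * p⁻¹) := by field_simp
    _ ≤ M * (2 * p⁻¹) := by gcongr
    _ = 2 * M * √(2 * Real.pi * v) * Real.exp ((|t| + (R + 1)) ^ 2 / (2 * v)) := by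
        rw [inv_gaussianPDFReal_zero]; ring_nf
    _ ≤ _ := by
        gcongr
        exact_mod_cast add_sq_div_two_mul_le v t (R + 1)

end Growth

/-! ### Functions of Gaussian growth -/

section GaussianGrowth

variable {v : ℝ≥0} {K L B : ℝ} {g g' : ℝ → ℝ}

lemma HasGaussianGrowth.nonneg (hg : HasGaussianGrowth v K g) : 0 ≤ K :=
  nonneg_of_mul_nonneg_left ((abs_nonneg _).trans (hg 0)) (Real.exp_pos _)

lemma HasGaussianGrowth.sub (hg : HasGaussianGrowth v K g) (hg' : HasGaussianGrowth v L g') :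
    HasGaussianGrowth v (K + L) fun t => g t - g' t := fun t => by
  rw [add_mul]
  exact (abs_sub _ _).trans (add_le_add (hg t) (hg' t))

lemma hasGaussianGrowth_id (hv : v ≠ 0) : HasGaussianGrowth v (1 + 3 * v) id := fun t => by
  have : (0 : ℝ) < v := by exact_mod_cast pos_iff_ne_zero.2 hv
  calc |t| ≤ 1 + t ^ 2 := by nlinarith [sq_abs t, sq_nonneg (|t| - 1), abs_nonneg t]
    _ ≤ 1 + t ^ 2 + (t ^ 2 / (3 * v) + 3 * v) := le_add_of_nonneg_right (by positivity)
    _ = (1 + 3 * (v : ℝ)) * (t ^ 2 / (3 * v) + 1) := by field_simp; ring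
    _ ≤ (1 + 3 * v) * Real.exp (t ^ 2 / (3 * v)) := by
        gcongr
        exact Real.add_one_le_exp _

/-- An integrable majorant, uniform over the shifts `|s| ≤ B`, of the product of a function of
Gaussian growth with constant `K` and the density of the normal distribution `N(s, v)`. -/
noncomputable def gaussMajorant (v : ℝ≥0) (K B t : ℝ) : ℝ :=
  K * ((√(2 * Real.pi * v))⁻¹ * Real.exp (5 * B ^ 2 / (2 * v))) *
    Real.exp (-(12 * v : ℝ)⁻¹ * t ^ 2)

lemma gaussMajorant_le (hK : 0 ≤ K) (B t : ℝ) :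
    gaussMajorant v K B t ≤ gaussMajorant v K B 0 := by
  rw [gaussMajorant, gaussMajorant]
  gcongr ?_ * Real.exp ?_
  have : 0 ≤ (12 * v : ℝ)⁻¹ * t ^ 2 := by positivity
  linarith

lemma integrable_gaussMajorant (hv : v ≠ 0) (K B : ℝ) : Integrable (gaussMajorant v K B) := by
  have : (0 : ℝ) < v := by exact_mod_cast pos_iff_ne_zero.2 hv
  exact (integrable_exp_neg_mul_sq (b := (12 * v : ℝ)⁻¹) (by positivity)).const_mul _

lemma integrable_gaussMajorant_mul (hv : v ≠ 0) (K B C : ℝ) :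
    Integrable fun t => gaussMajorant v K B t * (|t| + C) := by
  have : (0 : ℝ) < v := by exact_mod_cast pos_iff_ne_zero.2 hv
  have hmul : Integrable fun t => gaussMajorant v K B t * |t| := by
    refine ((integrable_mul_exp_neg_mul_sq (b := (12 * v : ℝ)⁻¹) (by positivity)).abs.const_mul
      (K * ((√(2 * Real.pi * v))⁻¹ * Real.exp (5 * B ^ 2 / (2 * v))))).congr
      (ae_of_all _ fun t => ?_)
    simp only [abs_mul, Real.abs_exp, gaussMajorant]
    ring
  simpa only [mul_add, Pi.add_def] using hmul.add ((integrable_gaussMajorant hv K B).mul_const C)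

lemma sq_div_sub_sq_div_le (v : ℝ≥0) (t s : ℝ) :
    t ^ 2 / (3 * v) + -(t - s) ^ 2 / (2 * v) ≤ 5 * s ^ 2 / (2 * v) + -(12 * v : ℝ)⁻¹ * t ^ 2 := by
  have hgap : 5 * s ^ 2 / (2 * v) + -(12 * v : ℝ)⁻¹ * t ^ 2 -
      (t ^ 2 / (3 * v) + -(t - s) ^ 2 / (2 * v)) = (t - 6 * s) ^ 2 / (12 * v) := by
    ring
  have : 0 ≤ (t - 6 * s) ^ 2 / (12 * v) := by positivity
  linarith

namespace HasGaussianGrowth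

lemma abs_mul_gaussianPDFReal_le (hg : HasGaussianGrowth v K g) {s : ℝ} (hs : |s| ≤ B) (t : ℝ) :
    |g t * gaussianPDFReal 0 v (t - s)| ≤ gaussMajorant v K B t := by
  have hK := hg.nonneg
  have hsB : s ^ 2 ≤ B ^ 2 := sq_le_sq.2 (hs.trans (le_abs_self B))
  rw [abs_mul, abs_of_nonneg (gaussianPDFReal_nonneg _ _ _), gaussianPDFReal_zero_apply]
  calc |g t| * ((√(2 * Real.pi * v))⁻¹ * Real.exp (-(t - s) ^ 2 / (2 * v)))
      ≤ K * Real.exp (t ^ 2 / (3 * v)) *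
        ((√(2 * Real.pi * v))⁻¹ * Real.exp (-(t - s) ^ 2 / (2 * v))) := by
        gcongr
        exact hg t
    _ = K * (√(2 * Real.pi * v))⁻¹ *
        Real.exp (t ^ 2 / (3 * v) + -(t - s) ^ 2 / (2 * v)) := by rw [Real.exp_add]; ring
    _ ≤ K * (√(2 * Real.pi * v))⁻¹ *
        Real.exp (5 * B ^ 2 / (2 * v) + -(12 * v : ℝ)⁻¹ * t ^ 2) := by
        refine mul_le_mul_of_nonneg_left (Real.exp_le_exp.2 ?_) (by positivity)
        exact (sq_div_sub_sq_div_le v t s).trans (by gcongr)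
    _ = gaussMajorant v K B t := by rw [Real.exp_add, gaussMajorant]; ring

lemma abs_mul_sub_mul_gaussianPDFReal_le (hg : HasGaussianGrowth v K g) {s : ℝ} (hs : |s| ≤ B)
    (t : ℝ) :
    |g t * ((t - s) / v * gaussianPDFReal 0 v (t - s))| ≤
      gaussMajorant v K B t * (|t| + B) / v := by
  have hbound := hg.abs_mul_gaussianPDFReal_le hs t
  have hassoc : g t * ((t - s) / v * gaussianPDFReal 0 v (t - s)) =
      g t * gaussianPDFReal 0 v (t - s) * (t - s) / v := by ring
  rw [hassoc, abs_div, abs_mul, NNReal.abs_eq]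
  gcongr
  · exact (abs_nonneg _).trans hbound
  · exact (abs_sub t s).trans (by gcongr)

lemma integrable_mul_gaussianPDFReal (hv : v ≠ 0) (hg : HasGaussianGrowth v K g)
    (hgm : Measurable g) (s : ℝ) : Integrable fun t => g t * gaussianPDFReal 0 v (t - s) := by
  have := measurable_gaussianPDFReal 0 v
  exact (integrable_gaussMajorant hv K |s|).mono' (by fun_prop)
    (ae_of_all _ (hg.abs_mul_gaussianPDFReal_le le_rfl))

lemma integrable_mul_sub_mul_gaussianPDFReal (hv : v ≠ 0) (hg : HasGaussianGrowth v K g)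
    (hgm : Measurable g) (s : ℝ) :
    Integrable fun t => g t * ((t - s) / v * gaussianPDFReal 0 v (t - s)) := by
  have := measurable_gaussianPDFReal 0 v
  exact ((integrable_gaussMajorant_mul hv K |s| |s|).div_const v).mono' (by fun_prop)
    (ae_of_all _ (hg.abs_mul_sub_mul_gaussianPDFReal_le le_rfl))

end HasGaussianGrowth

end GaussianGrowth

/-! ### Integration by parts -/

lemma integrable_of_hasDerivAt_of_nonneg_of_abs_le {h h' : ℝ → ℝ} {C : ℝ}
    (hh : ∀ t, HasDerivAt h (h' t) t) (h0 : ∀ t, 0 ≤ h' t) (hC : ∀ t, |h t| ≤ C) :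
    Integrable h' := by
  have hi (a b : ℝ) : IntervalIntegrable h' volume a b :=
    intervalIntegral.intervalIntegrable_deriv_of_nonneg
      (fun t _ => (hh t).continuousAt.continuousWithinAt) (fun t _ => hh t) fun t _ => h0 t
  refine integrable_of_intervalIntegral_norm_bounded (μ := volume) (l := atTop)
    (a := fun n : ℕ => -(n : ℝ)) (b := fun n : ℕ => (n : ℝ)) (2 * C) (fun n => (hi _ _).1)
    (tendsto_neg_atTop_atBot.comp tendsto_natCast_atTop_atTop) tendsto_natCast_atTop_atTop
    (Eventually.of_forall fun n => ?_)
  simp only [Real.norm_of_nonneg (h0 _)]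
  rw [intervalIntegral.integral_eq_sub_of_hasDerivAt (fun t _ => hh t) (hi _ _)]
  linarith [le_of_abs_le (hC n), neg_le_of_abs_le (hC (-n))]

lemma integrable_deriv_mul_of_integrable_mul_deriv {g g' φ φ' : ℝ → ℝ} {C : ℝ}
    (hg : ∀ t, HasDerivAt g (g' t) t) (hφ : ∀ t, HasDerivAt φ (φ' t) t) (hφ' : Continuous φ')
    (h0 : ∀ t, 0 ≤ g' t * φ t) (hC : ∀ t, |g t * φ t| ≤ C)
    (hint : Integrable fun t => g t * φ' t) : Integrable fun t => g' t * φ t := by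
  have hgc : Continuous g := continuous_iff_continuousAt.2 fun t => (hg t).continuousAt
  have hcont : Continuous fun t => g t * φ' t := hgc.mul hφ'
  -- `g' φ` is the derivative of the bounded function `g φ - ∫₀ g φ'`.
  refine integrable_of_hasDerivAt_of_nonneg_of_abs_le (C := C + ∫ t, |g t * φ' t|)
    (h := fun t => g t * φ t - ∫ r in (0 : ℝ)..t, g r * φ' r) (fun t => ?_) h0 fun t => ?_
  · refine (((hg t).mul (hφ t)).sub (intervalIntegral.integral_hasDerivAt_right
      (hcont.intervalIntegrable _ _) (hcont.stronglyMeasurableAtFilter _ _)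
      hcont.continuousAt)).congr_deriv (add_sub_cancel_right _ _)
  · refine (abs_sub _ _).trans (add_le_add (hC t) ?_)
    exact (intervalIntegral.norm_integral_le_integral_norm_uIoc).trans
      (setIntegral_le_integral hint.norm (ae_of_all _ fun r => norm_nonneg _))

section Stein

variable {v : ℝ≥0} {K : ℝ} {g : ℝ → ℝ}

lemma hasDerivAt_gaussianPDFReal_zero_sub (v : ℝ≥0) (s t : ℝ) :
    HasDerivAt (fun t => gaussianPDFReal 0 v (t - s))
      (-((t - s) / v * gaussianPDFReal 0 v (t - s))) t := by
  rw [← neg_mul]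
  exact (hasDerivAt_gaussianPDFReal_zero v (t - s)).comp_sub_const t s

lemma integrable_deriv_mul_gaussianPDFReal (hv : v ≠ 0) (hg : Differentiable ℝ g)
    (hmono : Monotone g) (hK : HasGaussianGrowth v K g) (s : ℝ) :
    Integrable fun t => deriv g t * gaussianPDFReal 0 v (t - s) := by
  have hpdf := continuous_gaussianPDFReal 0 v
  refine integrable_deriv_mul_of_integrable_mul_deriv (fun t => (hg t).hasDerivAt)
    (hasDerivAt_gaussianPDFReal_zero_sub v s) (by fun_prop)
    (fun t => mul_nonneg hmono.deriv_nonneg (gaussianPDFReal_nonneg _ _ _))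
    (fun t => (hK.abs_mul_gaussianPDFReal_le le_rfl t).trans (gaussMajorant_le hK.nonneg _ t)) ?_
  simpa only [mul_neg, Pi.neg_def] using
    (hK.integrable_mul_sub_mul_gaussianPDFReal hv hg.continuous.measurable s).neg

/-- Stein's identity. -/
lemma integral_deriv_mul_gaussianPDFReal (hv : v ≠ 0) (hg : Differentiable ℝ g)
    (hmono : Monotone g) (hK : HasGaussianGrowth v K g) (s : ℝ) :
    ∫ t, deriv g t * gaussianPDFReal 0 v (t - s) =
      ∫ t, g t * ((t - s) / v * gaussianPDFReal 0 v (t - s)) := by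
  have hgm := hg.continuous.measurable
  have parts := integral_mul_deriv_eq_deriv_mul_of_integrable (u := g)
    (fun t _ => (hg t).hasDerivAt) (fun t _ => hasDerivAt_gaussianPDFReal_zero_sub v s t)
    (by simpa only [Pi.mul_def, Pi.neg_def, mul_neg] using
      (hK.integrable_mul_sub_mul_gaussianPDFReal hv hgm s).neg)
    (integrable_deriv_mul_gaussianPDFReal hv hg hmono hK s)
    (hK.integrable_mul_gaussianPDFReal hv hgm s)
  simp only [mul_neg, integral_neg, neg_inj] at parts
  exact parts.symm

end Stein

/-! ### Slices of regularized measures -/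

lemma integral_mul_le_sqrt_mul_sqrt {α : Type*} [MeasurableSpace α] {μ : Measure α}
    {f g : α → ℝ} (hf : MemLp f 2 μ) (hg : MemLp g 2 μ) :
    ∫ a, f a * g a ∂μ ≤ √(∫ a, f a ^ 2 ∂μ) * √(∫ a, g a ^ 2 ∂μ) := by
  have holder := integral_mul_norm_le_Lp_mul_Lq Real.HolderConjugate.two_two
    (by simpa only [ENNReal.ofReal_ofNat] using hf) (by simpa only [ENNReal.ofReal_ofNat] using hg)
  simp only [Real.rpow_ofNat, Real.norm_eq_abs, sq_abs, ← Real.sqrt_eq_rpow] at holder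
  refine le_trans ?_ holder
  simp only [← abs_mul]
  exact integral_mono (hg.integrable_mul hf |>.congr (ae_of_all _ fun _ => mul_comm _ _))
    (hf.integrable_mul hg).abs fun a => le_abs_self _

section Slices

variable {k : ℕ} {σ : ℝ}

instance (μ : P2 k) : IsProbabilityMeasure μ.1 := μ.2.1

instance (k : ℕ) (σ : ℝ) : IsProbabilityMeasure (gauss k σ) := by
  unfold gauss
  infer_instance

instance (σ : ℝ) (μ : Measure (Euc k)) [IsProbabilityMeasure μ] :
    IsProbabilityMeasure (reg σ μ) := by
  unfold reg
  infer_instance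

instance (θ : Sph k) (μ : Measure (Euc k)) [IsProbabilityMeasure μ] :
    IsProbabilityMeasure (slice θ μ) :=
  Measure.isProbabilityMeasure_map (by fun_prop)

instance isProbabilityMeasure_unif [NeZero k] : IsProbabilityMeasure (unif k) where
  measure_univ := by
    have : Nonempty (Fin k) := ⟨0⟩
    rw [unif, Measure.smul_apply, smul_eq_mul]
    exact ENNReal.inv_mul_cancel (Measure.measure_univ_ne_zero.2 (Measure.toSphere_ne_zero _))
      (measure_ne_top _ _)

lemma abs_inner_sph_le (θ : Sph k) (x : Euc k) : |inner ℝ (θ : Euc k) x| ≤ ‖x‖ := by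
  simpa only [norm_eq_of_mem_sphere, one_mul] using abs_real_inner_le_norm (θ : Euc k) x

/-- The variance `σ²` as a nonnegative real. -/
noncomputable def sigmaSq (σ : ℝ) : ℝ≥0 := ⟨σ ^ 2, sq_nonneg σ⟩

lemma coe_sigmaSq (σ : ℝ) : (sigmaSq σ : ℝ) = σ ^ 2 := rfl

lemma sigmaSq_ne_zero (hσ : σ ≠ 0) : sigmaSq σ ≠ 0 := by
  rw [← NNReal.coe_ne_zero, coe_sigmaSq]
  exact pow_ne_zero 2 hσ

lemma charFun_slice (θ : Sph k) (μ : Measure (Euc k)) (t : ℝ) :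
    charFun (slice θ μ) t = charFun μ (t • (θ : Euc k)) := by
  rw [charFun_apply_real, charFun_apply, slice, integral_map (by fun_prop) (by fun_prop)]
  simp only [real_inner_smul_right, real_inner_comm, Complex.ofReal_mul]

lemma charFun_gauss (k : ℕ) (σ : ℝ) (x : Euc k) :
    charFun (gauss k σ) x = Complex.exp (-(σ ^ 2 * ‖x‖ ^ 2 / 2 : ℝ)) := by
  have hnorm : x.ofLp ⬝ᵥ x.ofLp = ‖x‖ ^ 2 := (real_inner_self_eq_norm_sq x)
  rw [gauss, charFun_multivariateGaussian (Matrix.PosSemidef.one.smul (sq_nonneg σ)),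
    Matrix.smul_mulVec, Matrix.one_mulVec, dotProduct_smul, hnorm]
  simp

lemma slice_gauss (θ : Sph k) : slice θ (gauss k σ) = gaussianReal 0 (sigmaSq σ) := by
  refine Measure.ext_of_charFun (funext fun t => ?_)
  rw [charFun_slice, charFun_gauss, charFun_gaussianReal, coe_sigmaSq, norm_smul,
    norm_eq_of_mem_sphere, mul_one, Real.norm_eq_abs, sq_abs]
  simp

lemma slice_reg (θ : Sph k) (μ : Measure (Euc k)) [IsProbabilityMeasure μ] :
    slice θ (reg σ μ) = (slice θ μ).conv (gaussianReal 0 (sigmaSq σ)) := by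
  rw [← slice_gauss θ]
  exact Measure.map_conv_continuousLinearMap (innerSL ℝ (θ : Euc k))

lemma regularCDF_slice_reg (hσ : σ ≠ 0) (θ : Sph k) (μ : Measure (Euc k))
    [IsProbabilityMeasure μ] : RegularCDF (slice θ (reg σ μ)) := by
  rw [slice_reg]
  exact regularCDF_conv_gaussianReal (sigmaSq_ne_zero hσ)

lemma memLp_id_gauss : MemLp id 2 (gauss k σ) := by
  unfold gauss
  exact IsGaussian.memLp_two_id

lemma memLp_id_reg {μ : Measure (Euc k)} [IsProbabilityMeasure μ] (hμ : MemLp id 2 μ) :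
    MemLp id 2 (reg σ μ) :=
  (memLp_map_measure_iff aestronglyMeasurable_id (by fun_prop)).2
    ((hμ.comp_measurePreserving measurePreserving_fst).add
      (memLp_id_gauss.comp_measurePreserving measurePreserving_snd))

lemma memLp_inner {μ : Measure (Euc k)} (hμ : MemLp id 2 μ) (θ : Sph k) :
    MemLp (fun x : Euc k => inner ℝ (θ : Euc k) x) 2 μ :=
  hμ.mono (by fun_prop) (ae_of_all _ (abs_inner_sph_le θ))

lemma memLp_id_slice {μ : Measure (Euc k)} (hμ : MemLp id 2 μ) (θ : Sph k) :
    MemLp id 2 (slice θ μ) :=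
  (memLp_map_measure_iff aestronglyMeasurable_id (by fun_prop)).2 (memLp_inner hμ θ)

lemma integral_sq_slice_le {μ : Measure (Euc k)} (hμ : MemLp id 2 μ) (θ : Sph k) :
    ∫ y, y ^ 2 ∂(slice θ μ) ≤ ∫ x, ‖x‖ ^ 2 ∂μ := by
  rw [slice, integral_map (by fun_prop) (by fun_prop)]
  refine integral_mono (memLp_inner hμ θ).integrable_sq
    (hμ.integrable_norm_pow two_ne_zero) fun x => ?_
  exact sq_le_sq.2 ((abs_inner_sph_le θ x).trans (le_abs_self _))

lemma transportMap_eq_monoMap (μ ν : P2 k) (θ : Sph k) :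
    transportMap σ μ ν θ = monoMap (slice θ (reg σ μ.1)) (slice θ (reg σ ν.1)) := rfl

lemma hasGaussianGrowth_transportMap (hσ : σ ≠ 0) {μ : P2 k} (ν : P2 k) {R : ℝ} (hR : 0 < R)
    (hμ : 2 * ∫ x, ‖x‖ ^ 2 ∂μ.1 ≤ R ^ 2) (θ : Sph k) :
    HasGaussianGrowth (sigmaSq σ)
      (growthConst (sigmaSq σ) (∫ y, ‖y‖ ^ 2 ∂(reg σ ν.1)) R) (transportMap σ μ ν θ) := by
  rw [transportMap_eq_monoMap, slice_reg θ μ.1]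
  have hν := memLp_id_reg (σ := σ) ν.2.2
  refine hasGaussianGrowth_monoMap (sigmaSq_ne_zero hσ) (memLp_id_slice μ.2.2 θ).integrable_sq hR
    ?_ (regularCDF_slice_reg hσ θ ν.1) (memLp_id_slice hν θ).integrable_sq
    (integral_sq_slice_le hν θ)
  linarith [integral_sq_slice_le μ.2.2 θ]

lemma differentiable_transportMap (hσ : σ ≠ 0) (μ ν : P2 k) (θ : Sph k) :
    Differentiable ℝ (transportMap σ μ ν θ) :=
  (regularCDF_slice_reg hσ θ μ.1).differentiable_monoMap (regularCDF_slice_reg hσ θ ν.1)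

lemma monotone_transportMap (hσ : σ ≠ 0) (μ ν : P2 k) (θ : Sph k) :
    Monotone (transportMap σ μ ν θ) :=
  (regularCDF_slice_reg hσ θ μ.1).monotone_monoMap (regularCDF_slice_reg hσ θ ν.1)

/-! ### Stability of the transport maps -/

lemma exists_coupling_of_W2_lt {μ' μ : P2 k} {δ : ℝ} (hδ : 0 < δ) (h : W2 μ' μ < δ) :
    ∃ π ∈ couplings μ'.1 μ.1, ∫ p, ‖p.1 - p.2‖ ^ 2 ∂π < 2 * δ ^ 2 :=
  exists_coupling_lt μ'.2.2 μ.2.2 ((Real.sqrt_lt' hδ).1 h)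

lemma exists_coupling_integral_norm_le_of_W2_lt {μ' μ : P2 k} {δ : ℝ} (hδ : 0 < δ)
    (h : W2 μ' μ < δ) : ∃ π ∈ couplings μ'.1 μ.1, ∫ p, ‖p.1 - p.2‖ ∂π ≤ 2 * δ := by
  obtain ⟨π, hπ, hlt⟩ := exists_coupling_of_W2_lt hδ h
  have := hπ.1
  refine ⟨π, hπ, ?_⟩
  have cauchySchwarz := integral_mul_le_sqrt_mul_sqrt
    (memLp_sub_of_mem_couplings μ'.2.2 μ.2.2 hπ).norm (memLp_const (1 : ℝ))
  simp only [mul_one, one_pow, integral_const, probReal_univ, one_smul, Real.sqrt_one]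
    at cauchySchwarz
  refine cauchySchwarz.trans (Real.sqrt_le_iff.2 ⟨by positivity, ?_⟩)
  nlinarith

lemma integral_norm_sq_le_of_W2_lt {μ' μ : P2 k} {δ : ℝ} (hδ : 0 < δ) (h : W2 μ' μ < δ) :
    ∫ x, ‖x‖ ^ 2 ∂μ'.1 ≤ 2 * ∫ x, ‖x‖ ^ 2 ∂μ.1 + 4 * δ ^ 2 := by
  obtain ⟨π, hπ, hlt⟩ := exists_coupling_of_W2_lt hδ h
  have hfst := measurePreserving_fst_of_mem_couplings hπ
  have hsnd := measurePreserving_snd_of_mem_couplings hπ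
  have hi₁ := hfst.integrable_comp_of_integrable (μ'.2.2.integrable_norm_pow two_ne_zero)
  have hi₂ := hsnd.integrable_comp_of_integrable (μ.2.2.integrable_norm_pow two_ne_zero)
  have hi := (memLp_sub_of_mem_couplings μ'.2.2 μ.2.2 hπ).integrable_norm_pow two_ne_zero
  rw [← hfst.map_eq, ← hsnd.map_eq, integral_map (by fun_prop) (by fun_prop),
    integral_map (by fun_prop) (by fun_prop)]
  calc ∫ p, ‖p.1‖ ^ 2 ∂π ≤ ∫ p, (2 * ‖p.2‖ ^ 2 + 2 * ‖p.1 - p.2‖ ^ 2) ∂π := by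
        refine integral_mono hi₁ ((hi₂.const_mul 2).add (hi.const_mul 2)) fun p => ?_
        have := pow_le_pow_left₀ (norm_nonneg _) (norm_le_norm_add_norm_sub' p.1 p.2) 2
        dsimp only
        nlinarith [sq_nonneg (‖p.2‖ - ‖p.1 - p.2‖)]
    _ = 2 * ∫ p, ‖p.2‖ ^ 2 ∂π + 2 * ∫ p, ‖p.1 - p.2‖ ^ 2 ∂π := by
        rw [← integral_const_mul, ← integral_const_mul]
        exact integral_add (hi₂.const_mul 2) (hi.const_mul 2)
    _ ≤ 2 * ∫ p, ‖p.2‖ ^ 2 ∂π + 4 * δ ^ 2 := by linarith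

lemma measurable_cdf_sub_inner (γ : Measure ℝ) (t : ℝ) (θ : Sph k) :
    Measurable fun x : Euc k => cdf γ (t - inner ℝ (θ : Euc k) x) :=
  (cdf γ).mono.measurable.comp (by fun_prop)

lemma cdf_slice_reg (μ : Measure (Euc k)) [IsProbabilityMeasure μ] (θ : Sph k) (t : ℝ) :
    cdf (slice θ (reg σ μ)) t =
      ∫ x, cdf (gaussianReal 0 (sigmaSq σ)) (t - inner ℝ (θ : Euc k) x) ∂μ := by
  rw [slice_reg, cdf_conv, slice, integral_map (by fun_prop)]
  exact ((cdf _).mono.measurable.comp (by fun_prop)).aestronglyMeasurable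

lemma abs_sub_inner_sub_le (θ' θ : Sph k) (t' t : ℝ) (x' x : Euc k) :
    |t' - inner ℝ (θ' : Euc k) x' - (t - inner ℝ (θ : Euc k) x)| ≤
      |t' - t| + ‖x' - x‖ + ‖(θ' : Euc k) - θ‖ * ‖x‖ := by
  have hsplit : t' - inner ℝ (θ' : Euc k) x' - (t - inner ℝ (θ : Euc k) x) =
      t' - t - inner ℝ (θ' : Euc k) (x' - x) - inner ℝ ((θ' : Euc k) - θ) x := by
    rw [inner_sub_right, inner_sub_left]
    ring
  rw [hsplit]
  exact (abs_sub _ _).trans (add_le_add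
    ((abs_sub _ _).trans (add_le_add le_rfl (abs_inner_sph_le θ' _))) (abs_real_inner_le_norm _ _))

lemma abs_cdf_slice_reg_sub_le_of_mem_couplings (hσ : σ ≠ 0) {μ' μ : Measure (Euc k)}
    [IsProbabilityMeasure μ'] [IsProbabilityMeasure μ] (hμ' : Integrable id μ')
    (hμ : Integrable id μ) {π : Measure (Euc k × Euc k)} (hπ : π ∈ couplings μ' μ)
    (θ' θ : Sph k) (t' t : ℝ) :
    |cdf (slice θ' (reg σ μ')) t' - cdf (slice θ (reg σ μ)) t| ≤
      (√(2 * Real.pi * sigmaSq σ))⁻¹ *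
        (|t' - t| + ∫ p, ‖p.1 - p.2‖ ∂π + ‖(θ' : Euc k) - θ‖ * ∫ x, ‖x‖ ∂μ) := by
  have := hπ.1
  have hfst := measurePreserving_fst_of_mem_couplings hπ
  have hsnd := measurePreserving_snd_of_mem_couplings hπ
  have hi₁ := hfst.integrable_comp_of_integrable hμ'
  have hi₂ := hsnd.integrable_comp_of_integrable hμ
  have hdiff : Integrable (fun p => ‖p.1 - p.2‖) π := (hi₁.sub hi₂).norm
  have hdiff' : Integrable (fun p => |t' - t| + ‖p.1 - p.2‖) π := (integrable_const _).add hdiff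
  have hsnd' : Integrable (fun p => ‖(θ' : Euc k) - θ‖ * ‖p.2‖) π := hi₂.norm.const_mul _
  set c := (√(2 * Real.pi * sigmaSq σ))⁻¹
  set Φ := cdf (gaussianReal 0 (sigmaSq σ))
  have hΦ (r : ℝ) (φ : Sph k) := measurable_cdf_sub_inner (gaussianReal 0 (sigmaSq σ)) r φ
  have hpointwise (p : Euc k × Euc k) :
      ‖Φ (t' - inner ℝ (θ' : Euc k) p.1) - Φ (t - inner ℝ (θ : Euc k) p.2)‖ ≤
        c * (|t' - t| + ‖p.1 - p.2‖ + ‖(θ' : Euc k) - θ‖ * ‖p.2‖) :=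
    (abs_cdf_gaussianReal_sub_le 0 (sigmaSq_ne_zero hσ) _ _).trans
      (mul_le_mul_of_nonneg_left (abs_sub_inner_sub_le θ' θ t' t p.1 p.2) (by positivity))
  rw [cdf_slice_reg, cdf_slice_reg, ← hfst.map_eq, ← hsnd.map_eq,
    integral_map measurable_fst.aemeasurable (hΦ t' θ').aestronglyMeasurable,
    integral_map measurable_snd.aemeasurable (hΦ t θ).aestronglyMeasurable,
    integral_map measurable_snd.aemeasurable (by fun_prop),
    ← integral_sub (integrable_cdf_comp _ (by fun_prop)) (integrable_cdf_comp _ (by fun_prop))]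
  calc |∫ p, (Φ (t' - inner ℝ (θ' : Euc k) p.1) - Φ (t - inner ℝ (θ : Euc k) p.2)) ∂π|
      ≤ ∫ p, c * (|t' - t| + ‖p.1 - p.2‖ + ‖(θ' : Euc k) - θ‖ * ‖p.2‖) ∂π := by
        refine norm_integral_le_of_norm_le ?_ (ae_of_all _ hpointwise)
        exact (hdiff'.add hsnd').const_mul c
    _ = c * (|t' - t| + ∫ p, ‖p.1 - p.2‖ ∂π + ‖(θ' : Euc k) - θ‖ * ∫ p, ‖p.2‖ ∂π) := by
        rw [integral_const_mul, integral_add hdiff' hsnd',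
          integral_add (integrable_const _) hdiff, integral_const, probReal_univ, one_smul,
          integral_const_mul]

lemma abs_cdf_slice_reg_sub_le (hσ : σ ≠ 0) (μ' μ : P2 k) (θ' θ : Sph k) (t' t : ℝ) :
    |cdf (slice θ' (reg σ μ'.1)) t' - cdf (slice θ (reg σ μ.1)) t| ≤
      (√(2 * Real.pi * sigmaSq σ))⁻¹ *
        (|t' - t| + 2 * W2 μ' μ + ‖(θ' : Euc k) - θ‖ * ∫ x, ‖x‖ ∂μ.1) := by
  refine ge_of_tendsto (x := 𝓝[>] (W2 μ' μ)) (f := fun δ => (√(2 * Real.pi * sigmaSq σ))⁻¹ *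
    (|t' - t| + 2 * δ + ‖(θ' : Euc k) - θ‖ * ∫ x, ‖x‖ ∂μ.1))
    ((Continuous.tendsto (by fun_prop) _).mono_left nhdsWithin_le_nhds)
    (eventually_mem_nhdsWithin.mono fun δ hδ => ?_)
  obtain ⟨π, hπ, hle⟩ :=
    exists_coupling_integral_norm_le_of_W2_lt ((Real.sqrt_nonneg _).trans_lt hδ) hδ
  refine (abs_cdf_slice_reg_sub_le_of_mem_couplings hσ (μ'.2.2.integrable one_le_two)
    (μ.2.2.integrable one_le_two) hπ θ' θ t' t).trans ?_
  gcongr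

lemma W2_self (μ : P2 k) : W2 μ μ = 0 := by
  have hle := W2sq_map_le μ.2.2 μ.2.2
  simp only [sub_self, norm_zero, Measure.map_id, ne_eq, OfNat.ofNat_ne_zero, not_false_eq_true,
    zero_pow, zero_div, integral_zero] at hle
  exact Real.sqrt_eq_zero'.2 hle

lemma tendsto_cdf_slice_reg (hσ : σ ≠ 0) {ι : Type*} {l : Filter ι} {μs : ι → P2 k} {μ : P2 k}
    {θs : ι → Sph k} {θ : Sph k} {ts : ι → ℝ} {t : ℝ}
    (hμ : Tendsto (fun i => W2 (μs i) μ) l (𝓝 0)) (hθ : Tendsto θs l (𝓝 θ))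
    (ht : Tendsto ts l (𝓝 t)) :
    Tendsto (fun i => cdf (slice (θs i) (reg σ (μs i).1)) (ts i)) l
      (𝓝 (cdf (slice θ (reg σ μ.1)) t)) := by
  rw [tendsto_iff_norm_sub_tendsto_zero]
  refine squeeze_zero (fun i => norm_nonneg _)
    (fun i => abs_cdf_slice_reg_sub_le hσ (μs i) μ (θs i) θ (ts i) t) ?_
  have ht' : Tendsto (fun i => |ts i - t|) l (𝓝 0) := by
    simpa only [sub_self, abs_zero] using (ht.sub_const t).abs
  have hθ' : Tendsto (fun i => ‖(θs i : Euc k) - θ‖) l (𝓝 0) :=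
    tendsto_iff_norm_sub_tendsto_zero.1 ((continuous_subtype_val.tendsto θ).comp hθ)
  simpa only [mul_zero, zero_mul, add_zero] using ((ht'.add (hμ.const_mul 2)).add
    (hθ'.mul_const (∫ x, ‖x‖ ∂μ.1))).const_mul (√(2 * Real.pi * sigmaSq σ))⁻¹

lemma tendsto_transportMap (hσ : σ ≠ 0) (ν : P2 k) {ι : Type*} {l : Filter ι} {μs : ι → P2 k}
    {μ : P2 k} {θs : ι → Sph k} {θ : Sph k} {ts : ι → ℝ} {t : ℝ}
    (hμ : Tendsto (fun i => W2 (μs i) μ) l (𝓝 0)) (hθ : Tendsto θs l (𝓝 θ))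
    (ht : Tendsto ts l (𝓝 t)) :
    Tendsto (fun i => transportMap σ (μs i) ν (θs i) (ts i)) l (𝓝 (transportMap σ μ ν θ t)) :=
  RegularCDF.tendsto_monoMap (fun i => regularCDF_slice_reg hσ _ _)
    (fun i => regularCDF_slice_reg hσ _ _) (regularCDF_slice_reg hσ _ _)
    (regularCDF_slice_reg hσ _ _)
    (fun x => tendsto_cdf_slice_reg hσ (by simpa only [W2_self] using tendsto_const_nhds) hθ
      tendsto_const_nhds) (tendsto_cdf_slice_reg hσ hμ hθ ht)

lemma continuous_transportMap (hσ : σ ≠ 0) (μ ν : P2 k) :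
    Continuous fun p : Sph k × ℝ => transportMap σ μ ν p.1 p.2 :=
  continuous_iff_continuousAt.2 fun p =>
    tendsto_transportMap hσ ν (by simpa only [W2_self] using tendsto_const_nhds)
      (continuous_fst.tendsto p) (continuous_snd.tendsto p)

end Slices

/-! ### Gaussian ridge averages -/

section RidgeAverage

variable {k : ℕ} {v : ℝ≥0} {K : ℝ} {f : Sph k → ℝ → ℝ}

/-- The average over the directions `θ` of `θ 𝔼[f_θ(θᵀ(x + N))]`, with `N` centred normal of
covariance `v I`. The expectation is written through the density of `θᵀ(x + N)`, so that `x` only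
enters through a smooth function. -/
noncomputable def ridgeAverage (v : ℝ≥0) (f : Sph k → ℝ → ℝ) (x : Euc k) : Euc k :=
  ∫ p : Sph k × ℝ, (f p.1 p.2 * gaussianPDFReal 0 v (p.2 - inner ℝ (p.1 : Euc k) x)) • (p.1 : Euc k)
    ∂((unif k).prod volume)

/-- The derivative in `x` of the integrand of `ridgeAverage`. -/
noncomputable def ridgeDeriv (v : ℝ≥0) (f : Sph k → ℝ → ℝ) (x : Euc k) (p : Sph k × ℝ) :
    Euc k →L[ℝ] Euc k :=
  (f p.1 p.2 * ((p.2 - inner ℝ (p.1 : Euc k) x) / v *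
    gaussianPDFReal 0 v (p.2 - inner ℝ (p.1 : Euc k) x))) •
      InnerProductSpace.rankOne ℝ (p.1 : Euc k) (p.1 : Euc k)

lemma norm_rankOne_sph (θ : Sph k) :
    ‖InnerProductSpace.rankOne ℝ (θ : Euc k) (θ : Euc k)‖ = 1 := by
  rw [InnerProductSpace.norm_rankOne, norm_eq_of_mem_sphere, mul_one]

lemma continuous_rankOne_sph :
    Continuous fun θ : Sph k => InnerProductSpace.rankOne ℝ (θ : Euc k) (θ : Euc k) := by
  have hrankOne (x : Euc k) : InnerProductSpace.rankOne ℝ x x =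
      ContinuousLinearMap.smulRightL ℝ (Euc k) (Euc k) (innerSL ℝ x) x := by
    ext y
    simp
  simp only [hrankOne]
  fun_prop

lemma measurable_gaussianPDFReal_sub_inner (v : ℝ≥0) (x : Euc k) :
    Measurable fun p : Sph k × ℝ => gaussianPDFReal 0 v (p.2 - inner ℝ (p.1 : Euc k) x) := by
  have := measurable_gaussianPDFReal 0 v
  fun_prop

lemma aestronglyMeasurable_ridge (hfm : Measurable fun p : Sph k × ℝ => f p.1 p.2) (x : Euc k)
    (m : Measure (Sph k × ℝ)) : AEStronglyMeasurable (fun p : Sph k × ℝ =>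
      (f p.1 p.2 * gaussianPDFReal 0 v (p.2 - inner ℝ (p.1 : Euc k) x)) • (p.1 : Euc k)) m :=
  ((hfm.mul (measurable_gaussianPDFReal_sub_inner v x)).smul
    (measurable_subtype_coe.comp measurable_fst)).aestronglyMeasurable

lemma aestronglyMeasurable_ridgeDeriv (hfm : Measurable fun p : Sph k × ℝ => f p.1 p.2)
    (x : Euc k) (m : Measure (Sph k × ℝ)) : AEStronglyMeasurable (ridgeDeriv v f x) m := by
  have := measurable_gaussianPDFReal_sub_inner v x
  have hfactor : Measurable fun p : Sph k × ℝ =>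
      f p.1 p.2 * ((p.2 - inner ℝ (p.1 : Euc k) x) / v *
        gaussianPDFReal 0 v (p.2 - inner ℝ (p.1 : Euc k) x)) := by fun_prop
  exact hfactor.aestronglyMeasurable.smul
    (continuous_rankOne_sph.comp continuous_fst).aestronglyMeasurable

lemma norm_ridge_le (hf : ∀ θ, HasGaussianGrowth v K (f θ)) {x : Euc k} {B : ℝ} (hx : ‖x‖ ≤ B)
    (p : Sph k × ℝ) :
    ‖(f p.1 p.2 * gaussianPDFReal 0 v (p.2 - inner ℝ (p.1 : Euc k) x)) • (p.1 : Euc k)‖ ≤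
      gaussMajorant v K B p.2 := by
  rw [norm_smul, norm_eq_of_mem_sphere, mul_one]
  exact (hf p.1).abs_mul_gaussianPDFReal_le ((abs_inner_sph_le p.1 x).trans hx) p.2

lemma norm_ridgeDeriv_le (hf : ∀ θ, HasGaussianGrowth v K (f θ)) {x : Euc k} {B : ℝ}
    (hx : ‖x‖ ≤ B) (p : Sph k × ℝ) :
    ‖ridgeDeriv v f x p‖ ≤ gaussMajorant v K B p.2 * (|p.2| + B) / v := by
  rw [ridgeDeriv, norm_smul, norm_rankOne_sph, mul_one]
  exact (hf p.1).abs_mul_sub_mul_gaussianPDFReal_le ((abs_inner_sph_le p.1 x).trans hx) p.2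

lemma hasFDerivAt_ridge (f : Sph k → ℝ → ℝ) (p : Sph k × ℝ) (x : Euc k) :
    HasFDerivAt (fun y : Euc k =>
      (f p.1 p.2 * gaussianPDFReal 0 v (p.2 - inner ℝ (p.1 : Euc k) y)) • (p.1 : Euc k))
      (ridgeDeriv v f x p) x := by
  have hinner : HasFDerivAt (fun y : Euc k => p.2 - inner ℝ (p.1 : Euc k) y)
      (-(innerSL ℝ (p.1 : Euc k))) x :=
    (innerSL ℝ (p.1 : Euc k)).hasFDerivAt.const_sub p.2
  have hpdf := (hasDerivAt_gaussianPDFReal_zero v (p.2 - inner ℝ (p.1 : Euc k) x)).comp_hasFDerivAt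
    x hinner
  refine ((hpdf.const_mul (f p.1 p.2)).smul_const (p.1 : Euc k)).congr_fderiv ?_
  ext z
  simp [ridgeDeriv, smul_smul]

lemma norm_le_of_mem_ball_one {E : Type*} [SeminormedAddCommGroup E] {x y : E}
    (hy : y ∈ Metric.ball x 1) : ‖y‖ ≤ ‖x‖ + 1 := by
  have := norm_le_norm_add_norm_sub' y x
  linarith [mem_ball_iff_norm.1 hy]

variable [NeZero k]

lemma integrable_ridge (hv : v ≠ 0) (hf : ∀ θ, HasGaussianGrowth v K (f θ))
    (hfm : Measurable fun p : Sph k × ℝ => f p.1 p.2) (x : Euc k) :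
    Integrable (fun p : Sph k × ℝ =>
      (f p.1 p.2 * gaussianPDFReal 0 v (p.2 - inner ℝ (p.1 : Euc k) x)) • (p.1 : Euc k))
      ((unif k).prod volume) :=
  ((integrable_gaussMajorant hv K ‖x‖).comp_snd (unif k)).mono'
    (aestronglyMeasurable_ridge hfm x _) (ae_of_all _ (norm_ridge_le hf le_rfl))

lemma integrable_ridgeDeriv (hv : v ≠ 0) (hf : ∀ θ, HasGaussianGrowth v K (f θ))
    (hfm : Measurable fun p : Sph k × ℝ => f p.1 p.2) (x : Euc k) :
    Integrable (ridgeDeriv v f x) ((unif k).prod volume) :=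
  (((integrable_gaussMajorant_mul hv K ‖x‖ ‖x‖).div_const v).comp_snd (unif k)).mono'
    (aestronglyMeasurable_ridgeDeriv hfm x _) (ae_of_all _ (norm_ridgeDeriv_le hf le_rfl))

lemma hasFDerivAt_ridgeAverage (hv : v ≠ 0) (hf : ∀ θ, HasGaussianGrowth v K (f θ))
    (hfm : Measurable fun p : Sph k × ℝ => f p.1 p.2) (x : Euc k) :
    HasFDerivAt (ridgeAverage v f) (∫ p, ridgeDeriv v f x p ∂((unif k).prod volume)) x :=
  hasFDerivAt_integral_of_dominated_of_fderiv_le (Metric.ball_mem_nhds x one_pos)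
    (Eventually.of_forall fun _ => aestronglyMeasurable_ridge hfm _ _)
    (integrable_ridge hv hf hfm x)
    (aestronglyMeasurable_ridgeDeriv hfm x _)
    (ae_of_all _ fun p _ hy => norm_ridgeDeriv_le hf (norm_le_of_mem_ball_one hy) p)
    (((integrable_gaussMajorant_mul hv K (‖x‖ + 1) (‖x‖ + 1)).div_const v).comp_snd (unif k))
    (ae_of_all _ fun p y _ => hasFDerivAt_ridge f p y)

lemma tendsto_ridgeAverage (hv : v ≠ 0) {ι : Type*} {l : Filter ι} [l.IsCountablyGenerated]
    {fs : ι → Sph k → ℝ → ℝ} {xs : ι → Euc k} {x : Euc k}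
    (hfm : ∀ i, Measurable fun p : Sph k × ℝ => fs i p.1 p.2)
    (hfs : ∀ᶠ i in l, ∀ θ, HasGaussianGrowth v K (fs i θ))
    (hlim : ∀ θ t, Tendsto (fun i => fs i θ t) l (𝓝 (f θ t))) (hx : Tendsto xs l (𝓝 x)) :
    Tendsto (fun i => ridgeAverage v (fs i) (xs i)) l (𝓝 (ridgeAverage v f x)) := by
  have hpdf := continuous_gaussianPDFReal 0 v
  refine tendsto_integral_filter_of_dominated_convergence
    (fun p => gaussMajorant v K (‖x‖ + 1) p.2)
    (Eventually.of_forall fun i => aestronglyMeasurable_ridge (hfm i) _ _) ?_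
    ((integrable_gaussMajorant hv _ _).comp_snd _) (ae_of_all _ fun p => ?_)
  · filter_upwards [hfs, hx.eventually (Metric.ball_mem_nhds x one_pos)] with i hi hxi
    exact ae_of_all _ (norm_ridge_le hi (norm_le_of_mem_ball_one hxi))
  · have hpdf_inner : Continuous fun y : Euc k =>
        gaussianPDFReal 0 v (p.2 - inner ℝ (p.1 : Euc k) y) := by fun_prop
    exact ((hlim p.1 p.2).mul ((hpdf_inner.tendsto x).comp hx)).smul_const _

end RidgeAverage

/-! ### The derivative field -/

section Field

variable {k : ℕ} {σ : ℝ}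

/-- The `L`-derivative of `SW2regSq σ · ν` at `μ`: the average over `θ` of
`θ 𝔼[θᵀ(x + N) - T_θ(θᵀ(x + N))]`. -/
noncomputable def gradField (σ : ℝ) (ν μ : P2 k) : Euc k → Euc k :=
  ridgeAverage (sigmaSq σ) fun θ t => t - transportMap σ μ ν θ t

/-- A radius that controls the second moment of every measure at `W2`-distance less than `1`
from `μ`. -/
noncomputable def momentRadius (μ : P2 k) : ℝ := 4 * ∫ x, ‖x‖ ^ 2 ∂μ.1 + 8

lemma momentRadius_pos (μ : P2 k) : 0 < momentRadius μ := by
  rw [momentRadius]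
  positivity

lemma two_mul_integral_le_of_W2_lt_one {μ' μ : P2 k} (h : W2 μ' μ < 1) :
    2 * ∫ x, ‖x‖ ^ 2 ∂μ'.1 ≤ momentRadius μ ^ 2 := by
  have hmoment := integral_norm_sq_le_of_W2_lt one_pos h
  have : 0 ≤ ∫ x, ‖x‖ ^ 2 ∂μ.1 := by positivity
  rw [momentRadius]
  nlinarith

/-- A growth constant for `T_θ` that is uniform in `θ` and in the source measure, as long as the
latter has `W2`-distance less than `1` from `μ`. -/
noncomputable def transportConst (σ : ℝ) (ν μ : P2 k) : ℝ :=
  growthConst (sigmaSq σ) (∫ y, ‖y‖ ^ 2 ∂(reg σ ν.1)) (momentRadius μ)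

lemma hasGaussianGrowth_transportMap_of_W2_lt_one (hσ : σ ≠ 0) {μ' μ : P2 k} (h : W2 μ' μ < 1)
    (ν : P2 k) (θ : Sph k) :
    HasGaussianGrowth (sigmaSq σ) (transportConst σ ν μ) (transportMap σ μ' ν θ) :=
  hasGaussianGrowth_transportMap hσ ν (momentRadius_pos μ) (two_mul_integral_le_of_W2_lt_one h) θ

lemma hasGaussianGrowth_transportMap_self (hσ : σ ≠ 0) (μ ν : P2 k) (θ : Sph k) :
    HasGaussianGrowth (sigmaSq σ) (transportConst σ ν μ) (transportMap σ μ ν θ) :=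
  hasGaussianGrowth_transportMap_of_W2_lt_one hσ (by rw [W2_self]; exact one_pos) ν θ

lemma hasGaussianGrowth_sub_transportMap_self (hσ : σ ≠ 0) (μ ν : P2 k) (θ : Sph k) :
    HasGaussianGrowth (sigmaSq σ) (1 + 3 * sigmaSq σ + transportConst σ ν μ)
      fun t => t - transportMap σ μ ν θ t :=
  (hasGaussianGrowth_id (sigmaSq_ne_zero hσ)).sub (hasGaussianGrowth_transportMap_self hσ μ ν θ)

lemma measurable_sub_transportMap (hσ : σ ≠ 0) (μ ν : P2 k) :
    Measurable fun p : Sph k × ℝ => p.2 - transportMap σ μ ν p.1 p.2 :=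
  measurable_snd.sub (continuous_transportMap hσ μ ν).measurable

variable [NeZero k]

lemma tendsto_gradField (hσ : σ ≠ 0) (ν : P2 k) {ι : Type*} {l : Filter ι}
    [l.IsCountablyGenerated] {μs : ι → P2 k} {μ : P2 k} {xs : ι → Euc k} {x : Euc k}
    (hμ : Tendsto (fun i => W2 (μs i) μ) l (𝓝 0)) (hx : Tendsto xs l (𝓝 x)) :
    Tendsto (fun i => gradField σ ν (μs i) (xs i)) l (𝓝 (gradField σ ν μ x)) :=
  tendsto_ridgeAverage (sigmaSq_ne_zero hσ) (fun i => measurable_sub_transportMap hσ (μs i) ν)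
    ((hμ.eventually (gt_mem_nhds one_pos)).mono fun _ hi θ =>
      (hasGaussianGrowth_id (sigmaSq_ne_zero hσ)).sub
        (hasGaussianGrowth_transportMap_of_W2_lt_one hσ hi ν θ))
    (fun _ t => (tendsto_transportMap hσ ν hμ tendsto_const_nhds tendsto_const_nhds).const_sub t) hx

lemma jointlyContinuous_gradField (hσ : σ ≠ 0) (ν : P2 k) :
    JointlyContinuous (gradField σ ν) := by
  intro μ x ε hε
  set l : Filter (P2 k) := comap (fun μ' => W2 μ' μ) (𝓝 0)
  have hW2 : Tendsto (fun μ' : P2 k => W2 μ' μ) l (𝓝 0) := tendsto_comap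
  have htendsto : Tendsto (fun q : P2 k × Euc k => gradField σ ν q.1 q.2) (l ×ˢ 𝓝 x)
      (𝓝 (gradField σ ν μ x)) :=
    tendsto_gradField hσ ν (hW2.comp tendsto_fst) tendsto_snd
  obtain ⟨s, hs, t, ht, hst⟩ := mem_prod_iff.1 (htendsto (Metric.ball_mem_nhds _ hε))
  obtain ⟨a, ha, has⟩ := (Metric.nhds_basis_ball.comap _).mem_iff.1 hs
  obtain ⟨b, hb, hbt⟩ := Metric.mem_nhds_iff.1 ht
  refine ⟨min a b, lt_min ha hb, fun μ' x' hμ' hx' => ?_⟩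
  have hμs : μ' ∈ s := has (by
    rw [mem_preimage, mem_ball_zero_iff, W2, Real.norm_of_nonneg (Real.sqrt_nonneg _)]
    exact hμ'.trans_le (min_le_left _ _))
  have hxt : x' ∈ t := hbt (mem_ball_iff_norm.2 (hx'.trans_le (min_le_right _ _)))
  have hball := hst (mk_mem_prod hμs hxt)
  rwa [mem_preimage, mem_ball_iff_norm] at hball

lemma hasFDerivAt_gradField_ridgeDeriv (hσ : σ ≠ 0) (ν μ : P2 k) (x : Euc k) :
    HasFDerivAt (gradField σ ν μ) (∫ p, ridgeDeriv (sigmaSq σ)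
      (fun θ t => t - transportMap σ μ ν θ t) x p ∂((unif k).prod volume)) x :=
  hasFDerivAt_ridgeAverage (sigmaSq_ne_zero hσ) (hasGaussianGrowth_sub_transportMap_self hσ μ ν)
    (measurable_sub_transportMap hσ μ ν) x

end Field

/-! ### The Hessian -/

lemma integrable_prod_of_integral_norm_le {α β E : Type*} {mα : MeasurableSpace α}
    {mβ : MeasurableSpace β} [NormedAddCommGroup E] {μ : Measure α} {ν : Measure β} [SFinite μ]
    [IsFiniteMeasure ν] {f : α × β → E} {C : ℝ} (hf : AEStronglyMeasurable f (μ.prod ν))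
    (hint : ∀ b, Integrable (fun a => f (a, b)) μ) (hC : ∀ b, ∫ a, ‖f (a, b)‖ ∂μ ≤ C) :
    Integrable f (μ.prod ν) := by
  refine (integrable_prod_iff' hf).2 ⟨ae_of_all _ hint, ?_⟩
  refine Integrable.of_bound hf.norm.prod_swap.integral_prod_right' C (ae_of_all _ fun b => ?_)
  rw [Real.norm_of_nonneg (integral_nonneg fun a => norm_nonneg _)]
  exact hC b

section Hessian

variable {k : ℕ} {σ : ℝ}

lemma map_inner_add_gauss (θ : Sph k) (x : Euc k) :
    (gauss k σ).map (fun z => inner ℝ (θ : Euc k) (x + z)) =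
      gaussianReal (inner ℝ (θ : Euc k) x) (sigmaSq σ) := by
  simp only [inner_add_right]
  rw [← Function.comp_def (fun t => inner ℝ (θ : Euc k) x + t),
    ← Measure.map_map (by fun_prop) (by fun_prop), ← slice, slice_gauss,
    gaussianReal_map_const_add, zero_add]

lemma gaussianPDFReal_eq_zero_sub (s : ℝ) (v : ℝ≥0) (t : ℝ) :
    gaussianPDFReal s v t = gaussianPDFReal 0 v (t - s) := by
  rw [gaussianPDFReal_sub, zero_add]

lemma integral_comp_inner (hσ : σ ≠ 0) {f : ℝ → ℝ} (hf : Measurable f) (θ : Sph k) (x : Euc k) :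
    ∫ z, f (inner ℝ (θ : Euc k) (x + z)) ∂(gauss k σ) =
      ∫ t, f t * gaussianPDFReal 0 (sigmaSq σ) (t - inner ℝ (θ : Euc k) x) := by
  rw [← integral_map (φ := fun z => inner ℝ (θ : Euc k) (x + z)) (by fun_prop)
    hf.aestronglyMeasurable, map_inner_add_gauss,
    integral_gaussianReal_eq_integral_smul (sigmaSq_ne_zero hσ)]
  simp only [smul_eq_mul, mul_comm, gaussianPDFReal_eq_zero_sub (inner ℝ (θ : Euc k) x)]

lemma integrable_comp_inner (hσ : σ ≠ 0) {f : ℝ → ℝ} (hf : Measurable f) {θ : Sph k} {x : Euc k}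
    (hi : Integrable fun t => f t * gaussianPDFReal 0 (sigmaSq σ) (t - inner ℝ (θ : Euc k) x)) :
    Integrable (fun z => f (inner ℝ (θ : Euc k) (x + z))) (gauss k σ) := by
  rw [← Function.comp_def f, ← integrable_map_measure hf.aestronglyMeasurable (by fun_prop),
    map_inner_add_gauss, gaussianReal_of_var_ne_zero _ (sigmaSq_ne_zero hσ),
    integrable_withDensity_iff (measurable_gaussianPDF _ _)
      (ae_of_all _ fun _ => gaussianPDF_lt_top)]
  simpa only [toReal_gaussianPDF, gaussianPDFReal_eq_zero_sub (inner ℝ (θ : Euc k) x)] using hi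

lemma integrable_deriv_transportMap_inner (hσ : σ ≠ 0) (μ ν : P2 k) (θ : Sph k) (x : Euc k) :
    Integrable (fun z => deriv (transportMap σ μ ν θ) (inner ℝ (θ : Euc k) (x + z)))
      (gauss k σ) :=
  integrable_comp_inner hσ (measurable_deriv _) (integrable_deriv_mul_gaussianPDFReal
    (sigmaSq_ne_zero hσ) (differentiable_transportMap hσ μ ν θ) (monotone_transportMap hσ μ ν θ)
    (hasGaussianGrowth_transportMap_self hσ μ ν θ) _)

lemma integral_deriv_transportMap_inner (hσ : σ ≠ 0) (μ ν : P2 k) (θ : Sph k) (x : Euc k) :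
    ∫ z, deriv (transportMap σ μ ν θ) (inner ℝ (θ : Euc k) (x + z)) ∂(gauss k σ) =
      ∫ t, transportMap σ μ ν θ t * ((t - inner ℝ (θ : Euc k) x) / sigmaSq σ *
        gaussianPDFReal 0 (sigmaSq σ) (t - inner ℝ (θ : Euc k) x)) := by
  rw [integral_comp_inner hσ (measurable_deriv _), integral_deriv_mul_gaussianPDFReal
    (sigmaSq_ne_zero hσ) (differentiable_transportMap hσ μ ν θ) (monotone_transportMap hσ μ ν θ)
    (hasGaussianGrowth_transportMap_self hσ μ ν θ)]

/-- Stein's identity for the transport map, as an expectation. -/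
lemma integral_deriv_transportMap_inner_eq_integral_mul (hσ : σ ≠ 0) (μ ν : P2 k) (θ : Sph k)
    (x : Euc k) :
    ∫ z, deriv (transportMap σ μ ν θ) (inner ℝ (θ : Euc k) (x + z)) ∂(gauss k σ) =
      ∫ z, transportMap σ μ ν θ (inner ℝ (θ : Euc k) (x + z)) *
        (inner ℝ (θ : Euc k) z / σ ^ 2) ∂(gauss k σ) := by
  have hT := (differentiable_transportMap hσ μ ν θ).continuous
  have hcomp := integral_comp_inner (σ := σ) hσ (f := fun t => transportMap σ μ ν θ t *
    ((t - inner ℝ (θ : Euc k) x) / σ ^ 2)) (by fun_prop) θ x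
  simp only [inner_add_right, add_sub_cancel_left] at hcomp ⊢
  rw [hcomp]
  simpa only [inner_add_right, coe_sigmaSq, mul_assoc]
    using integral_deriv_transportMap_inner hσ μ ν θ x

lemma integral_one_sub_deriv_transportMap_inner (hσ : σ ≠ 0) (μ ν : P2 k) (θ : Sph k)
    (x : Euc k) :
    ∫ z, (1 - deriv (transportMap σ μ ν θ) (inner ℝ (θ : Euc k) (x + z))) ∂(gauss k σ) =
      ∫ t, (t - transportMap σ μ ν θ t) * ((t - inner ℝ (θ : Euc k) x) / sigmaSq σ *
        gaussianPDFReal 0 (sigmaSq σ) (t - inner ℝ (θ : Euc k) x)) := by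
  have hv := sigmaSq_ne_zero hσ
  have hid := integral_deriv_mul_gaussianPDFReal hv differentiable_id monotone_id
    (hasGaussianGrowth_id hv) (inner ℝ (θ : Euc k) x)
  simp only [deriv_id, id] at hid
  have hone : ∫ _, (1 : ℝ) ∂(gauss k σ) = _ :=
    (integral_comp_inner hσ (measurable_const (a := (1 : ℝ))) θ x).trans hid
  rw [integral_sub (integrable_const 1) (integrable_deriv_transportMap_inner hσ μ ν θ x), hone,
    integral_deriv_transportMap_inner hσ, ← integral_sub]
  · simp only [sub_mul]
  · exact (hasGaussianGrowth_id hv).integrable_mul_sub_mul_gaussianPDFReal hv measurable_id _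
  · exact (hasGaussianGrowth_transportMap_self hσ μ ν θ).integrable_mul_sub_mul_gaussianPDFReal hv
      (differentiable_transportMap hσ μ ν θ).continuous.measurable _

lemma measurable_deriv_transportMap (hσ : σ ≠ 0) (μ ν : P2 k) :
    Measurable fun p : Sph k × ℝ => deriv (transportMap σ μ ν p.1) p.2 :=
  measurable_deriv_with_param (continuous_transportMap hσ μ ν)

lemma stronglyMeasurable_hessIntegrand (hσ : σ ≠ 0) (μ ν : P2 k) (x : Euc k) :
    StronglyMeasurable fun p : Euc k × Sph k => hessIntegrand σ μ ν x p.1 p.2 := by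
  have hderiv : Measurable fun p : Euc k × Sph k =>
      deriv (transportMap σ μ ν p.2) (inner ℝ (p.2 : Euc k) (x + p.1)) :=
    (measurable_deriv_transportMap hσ μ ν).comp (f := fun p : Euc k × Sph k =>
      (p.2, inner ℝ (p.2 : Euc k) (x + p.1))) (by fun_prop)
  exact (hderiv.const_sub 1).stronglyMeasurable.smul
    (continuous_rankOne_sph.comp continuous_snd).stronglyMeasurable

lemma norm_hessIntegrand_le (hσ : σ ≠ 0) (μ ν : P2 k) (x z : Euc k) (θ : Sph k) :
    ‖hessIntegrand σ μ ν x z θ‖ ≤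
      1 + deriv (transportMap σ μ ν θ) (inner ℝ (θ : Euc k) (x + z)) := by
  rw [hessIntegrand, norm_smul, norm_rankOne_sph, mul_one]
  refine (norm_sub_le _ _).trans_eq ?_
  rw [norm_one, Real.norm_of_nonneg (monotone_transportMap hσ μ ν θ).deriv_nonneg]

lemma integrable_one_add_deriv_transportMap_inner (hσ : σ ≠ 0) (μ ν : P2 k) (θ : Sph k)
    (x : Euc k) :
    Integrable (fun z => 1 + deriv (transportMap σ μ ν θ) (inner ℝ (θ : Euc k) (x + z)))
      (gauss k σ) :=
  (integrable_const 1).add (integrable_deriv_transportMap_inner hσ μ ν θ x)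

lemma integrable_hessIntegrand_left (hσ : σ ≠ 0) (μ ν : P2 k) (x : Euc k) (θ : Sph k) :
    Integrable (fun z => hessIntegrand σ μ ν x z θ) (gauss k σ) :=
  (integrable_one_add_deriv_transportMap_inner hσ μ ν θ x).mono'
    ((stronglyMeasurable_hessIntegrand hσ μ ν x).comp_measurable (g := fun z => (z, θ))
      (by fun_prop)).aestronglyMeasurable
    (ae_of_all _ fun z => norm_hessIntegrand_le hσ μ ν x z θ)

lemma integral_norm_hessIntegrand_le (hσ : σ ≠ 0) (μ ν : P2 k) (x : Euc k) (θ : Sph k) :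
    ∫ z, ‖hessIntegrand σ μ ν x z θ‖ ∂(gauss k σ) ≤
      1 + ∫ z, deriv (transportMap σ μ ν θ) (inner ℝ (θ : Euc k) (x + z)) ∂(gauss k σ) := by
  refine (integral_mono (integrable_hessIntegrand_left hσ μ ν x θ).norm
    (integrable_one_add_deriv_transportMap_inner hσ μ ν θ x)
    fun z => norm_hessIntegrand_le hσ μ ν x z θ).trans_eq ?_
  rw [integral_add (integrable_const 1) (integrable_deriv_transportMap_inner hσ μ ν θ x)]
  simp only [integral_const, probReal_univ, one_smul]

lemma integral_deriv_transportMap_inner_le (hσ : σ ≠ 0) (μ ν : P2 k) (x : Euc k) (θ : Sph k) :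
    ∫ z, deriv (transportMap σ μ ν θ) (inner ℝ (θ : Euc k) (x + z)) ∂(gauss k σ) ≤
      ∫ t, gaussMajorant (sigmaSq σ) (transportConst σ ν μ) ‖x‖ t * (|t| + ‖x‖) / sigmaSq σ := by
  have hgrowth := hasGaussianGrowth_transportMap_self hσ μ ν θ
  rw [integral_deriv_transportMap_inner hσ]
  refine integral_mono (hgrowth.integrable_mul_sub_mul_gaussianPDFReal (sigmaSq_ne_zero hσ)
    (differentiable_transportMap hσ μ ν θ).continuous.measurable _)
    ((integrable_gaussMajorant_mul (sigmaSq_ne_zero hσ) _ ‖x‖ ‖x‖).div_const _) fun t => ?_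
  exact (le_abs_self _).trans
    (hgrowth.abs_mul_sub_mul_gaussianPDFReal_le (abs_inner_sph_le θ x) t)

variable [NeZero k]

lemma integrable_hessIntegrand (hσ : σ ≠ 0) (μ ν : P2 k) (x : Euc k) :
    Integrable (fun p : Euc k × Sph k => hessIntegrand σ μ ν x p.1 p.2)
      ((gauss k σ).prod (unif k)) :=
  integrable_prod_of_integral_norm_le
    (stronglyMeasurable_hessIntegrand hσ μ ν x).aestronglyMeasurable
    (integrable_hessIntegrand_left hσ μ ν x) fun θ =>
      (integral_norm_hessIntegrand_le hσ μ ν x θ).trans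
        (add_le_add_right (integral_deriv_transportMap_inner_le hσ μ ν x θ) 1)

lemma integral_ridgeDeriv_eq_integral_hessIntegrand (hσ : σ ≠ 0) (ν μ : P2 k) (x : Euc k) :
    ∫ p, ridgeDeriv (sigmaSq σ) (fun θ t => t - transportMap σ μ ν θ t) x p
        ∂((unif k).prod volume) =
      ∫ z, ∫ θ, hessIntegrand σ μ ν x z θ ∂(unif k) ∂(gauss k σ) := by
  rw [integral_prod _ (integrable_ridgeDeriv (sigmaSq_ne_zero hσ)
      (hasGaussianGrowth_sub_transportMap_self hσ μ ν) (measurable_sub_transportMap hσ μ ν) x),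
    integral_integral_swap (f := fun z θ => hessIntegrand σ μ ν x z θ)
      (integrable_hessIntegrand hσ μ ν x)]
  refine integral_congr_ae (ae_of_all _ fun θ => ?_)
  simp only [ridgeDeriv, hessIntegrand]
  rw [integral_smul_const, integral_smul_const, integral_one_sub_deriv_transportMap_inner hσ]

lemma hasFDerivAt_gradField (hσ : σ ≠ 0) (ν μ : P2 k) (x : Euc k) :
    HasFDerivAt (gradField σ ν μ)
      (∫ z, ∫ θ, hessIntegrand σ μ ν x z θ ∂(unif k) ∂(gauss k σ)) x :=
  integral_ridgeDeriv_eq_integral_hessIntegrand hσ ν μ x ▸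
    hasFDerivAt_gradField_ridgeDeriv hσ ν μ x

end Hessian

/-! ### The transported noise -/

lemma memLp_inner_sph {α : Type*} [MeasurableSpace α] {P : Measure α} {k : ℕ}
    {θ : α → Sph k} {F : α → Euc k} (hθ : Measurable θ) (hF : MemLp F 2 P) :
    MemLp (fun a => inner ℝ (θ a : Euc k) (F a)) 2 P :=
  hF.mono ((measurable_subtype_coe.comp hθ).aestronglyMeasurable.inner hF.aestronglyMeasurable)
    (ae_of_all _ fun a => abs_inner_sph_le (θ a) (F a))

section Noise

variable {k : ℕ} {σ : ℝ}

/-- The joint law of the noise `N_σ` and of an independent uniform direction. -/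
noncomputable abbrev noise (k : ℕ) (σ : ℝ) : Measure (Euc k × Sph k) :=
  (gauss k σ).prod (unif k)

/-- The optimal transport, direction by direction, of the projections of `X + N_σ`; the law of
`X` is meant to be `μ`. -/
noncomputable def transported (σ : ℝ) (μ ν : P2 k) {Ω : Type*} (X : Ω → Euc k)
    (q : Ω × (Euc k × Sph k)) : ℝ :=
  transportMap σ μ ν q.2.2 (inner ℝ (q.2.2 : Euc k) (X q.1 + q.2.1))

lemma measurable_transportMap_inner (hσ : σ ≠ 0) (μ ν : P2 k) :
    Measurable fun p : Euc k × Sph k =>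
      transportMap σ μ ν p.2 (inner ℝ (p.2 : Euc k) p.1) :=
  (continuous_transportMap hσ μ ν).measurable.comp (f := fun p : Euc k × Sph k =>
    (p.2, inner ℝ (p.2 : Euc k) p.1)) (by fun_prop)

variable [NeZero k]

lemma measurePreserving_add_noise (μ : Measure (Euc k)) [IsProbabilityMeasure μ] :
    MeasurePreserving (fun q : Euc k × (Euc k × Sph k) => (q.1 + q.2.1, q.2.2))
      (μ.prod (noise k σ)) ((reg σ μ).prod (unif k)) := by
  have hadd : MeasurePreserving (fun p : Euc k × Euc k => p.1 + p.2) (μ.prod (gauss k σ))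
      (reg σ μ) := ⟨by fun_prop, rfl⟩
  exact (hadd.prod (MeasurePreserving.id (unif k))).comp
    (measurePreserving_prodAssoc μ (gauss k σ) (unif k)).symm

omit [NeZero k] in
lemma measurePreserving_transportMap (hσ : σ ≠ 0) (μ ν : P2 k) (θ : Sph k) :
    MeasurePreserving (transportMap σ μ ν θ) (slice θ (reg σ μ.1)) (slice θ (reg σ ν.1)) where
  measurable := (differentiable_transportMap hσ μ ν θ).continuous.measurable
  map_eq := by
    rw [transportMap_eq_monoMap]
    exact (regularCDF_slice_reg hσ θ μ.1).map_monoMap (regularCDF_slice_reg hσ θ ν.1)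

lemma map_transportMap_inner_prod_unif (hσ : σ ≠ 0) (μ ν : P2 k) :
    ((reg σ μ.1).prod (unif k)).map
        (fun p => transportMap σ μ ν p.2 (inner ℝ (p.2 : Euc k) p.1)) =
      ((reg σ ν.1).prod (unif k)).map (fun p => inner ℝ (p.2 : Euc k) p.1) := by
  ext s hs
  have hT := measurable_transportMap_inner hσ μ ν
  have hinner : Measurable fun p : Euc k × Sph k => inner ℝ (p.2 : Euc k) p.1 := by fun_prop
  rw [Measure.map_apply hT hs, Measure.map_apply hinner hs,
    Measure.prod_apply_symm (hT hs), Measure.prod_apply_symm (hinner hs)]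
  refine lintegral_congr fun θ => ?_
  have hTθ := (measurePreserving_transportMap hσ μ ν θ).measurable
  have hmap := (measurePreserving_transportMap hσ μ ν θ).map_eq
  rw [slice, slice, Measure.map_map hTθ (by fun_prop)] at hmap
  have hmap_s := DFunLike.congr_fun hmap s
  rwa [Measure.map_apply (hTθ.comp (by fun_prop)) hs, Measure.map_apply (by fun_prop) hs]
    at hmap_s

variable {Ω : Type*} {mΩ : MeasurableSpace Ω} {P : Measure Ω} [IsProbabilityMeasure P]
  {μ : P2 k} {X : Ω → Euc k}

omit [NeZero k] in
lemma measurable_transported (hσ : σ ≠ 0) (μ ν : P2 k) (hX : Measurable X) :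
    Measurable (transported σ μ ν X) :=
  (measurable_transportMap_inner hσ μ ν).comp (f := fun q : Ω × (Euc k × Sph k) =>
    (X q.1 + q.2.1, q.2.2)) (by fun_prop)

lemma identDistrib_transported (hσ : σ ≠ 0) (ν : P2 k) (hX : MeasurePreserving X P μ.1) :
    IdentDistrib (transported σ μ ν X) (fun p => inner ℝ (p.2 : Euc k) p.1) (P.prod (noise k σ))
      ((reg σ ν.1).prod (unif k)) where
  aemeasurable_fst := (measurable_transported hσ μ ν hX.measurable).aemeasurable
  aemeasurable_snd := by fun_prop
  map_eq := by
    have hadd := (measurePreserving_add_noise (σ := σ) μ.1).comp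
      (hX.prod (MeasurePreserving.id (noise k σ)))
    rw [← map_transportMap_inner_prod_unif hσ, ← hadd.map_eq,
      Measure.map_map (measurable_transportMap_inner hσ μ ν) hadd.measurable]
    rfl

lemma memLp_inner_prod_unif (ν : P2 k) :
    MemLp (fun p : Euc k × Sph k => inner ℝ (p.2 : Euc k) p.1) 2 ((reg σ ν.1).prod (unif k)) :=
  memLp_inner_sph measurable_snd
    ((memLp_id_reg ν.2.2).comp_measurePreserving measurePreserving_fst)

lemma memLp_transported (hσ : σ ≠ 0) (ν : P2 k) (hX : MeasurePreserving X P μ.1) :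
    MemLp (transported σ μ ν X) 2 (P.prod (noise k σ)) :=
  (identDistrib_transported hσ ν hX).memLp_iff.2 (memLp_inner_prod_unif ν)

lemma integral_sq_transported_le (hσ : σ ≠ 0) (ν : P2 k) (hX : MeasurePreserving X P μ.1) :
    ∫ q, transported σ μ ν X q ^ 2 ∂(P.prod (noise k σ)) ≤ ∫ y, ‖y‖ ^ 2 ∂(reg σ ν.1) := by
  have hsq := ((memLp_id_reg (σ := σ) ν.2.2).comp_measurePreserving
    (measurePreserving_fst (ν := unif k))).integrable_norm_pow two_ne_zero
  calc ∫ q, transported σ μ ν X q ^ 2 ∂(P.prod (noise k σ))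
      = ∫ p, inner ℝ (p.2 : Euc k) p.1 ^ 2 ∂((reg σ ν.1).prod (unif k)) :=
        (identDistrib_transported hσ ν hX).sq.integral_eq
    _ ≤ ∫ p : Euc k × Sph k, ‖p.1‖ ^ 2 ∂((reg σ ν.1).prod (unif k)) :=
        integral_mono (memLp_inner_prod_unif ν).integrable_sq hsq fun p =>
          sq_le_sq.2 ((abs_inner_sph_le p.2 p.1).trans (le_abs_self _))
    _ = ∫ y, ‖y‖ ^ 2 ∂(reg σ ν.1) := by
        rw [integral_fun_fst (fun y : Euc k => ‖y‖ ^ 2), probReal_univ, one_smul]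

end Noise

/-! ### The integral bound for the Hessian -/

section Bound

variable {k : ℕ} {σ : ℝ}

lemma integral_inner_sq_gauss (θ : Sph k) :
    ∫ z, inner ℝ (θ : Euc k) z ^ 2 ∂(gauss k σ) = σ ^ 2 := by
  have hvar := variance_of_integral_eq_zero (μ := gaussianReal 0 (sigmaSq σ)) (X := fun t => t)
    aemeasurable_id integral_id_gaussianReal
  rw [variance_fun_id_gaussianReal, coe_sigmaSq, ← slice_gauss θ, slice,
    integral_map (by fun_prop) (by fun_prop)] at hvar
  exact hvar.symm

variable [NeZero k]

lemma memLp_score : MemLp (fun r : Euc k × Sph k => inner ℝ (r.2 : Euc k) r.1 / σ ^ 2) 2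
    (noise k σ) :=
  (memLp_inner_sph measurable_snd
    (memLp_id_gauss.comp_measurePreserving measurePreserving_fst)).mul_const _

lemma integral_sq_score (hσ : σ ≠ 0) :
    ∫ r : Euc k × Sph k, (inner ℝ (r.2 : Euc k) r.1 / σ ^ 2) ^ 2 ∂(noise k σ) = (1 / σ) ^ 2 := by
  rw [integral_prod_symm _ memLp_score.integrable_sq]
  simp only [div_pow, integral_div, integral_inner_sq_gauss, integral_const, probReal_univ,
    one_smul]
  field_simp

lemma integrable_deriv_transportMap_noise (hσ : σ ≠ 0) (μ ν : P2 k) (x : Euc k) :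
    Integrable (fun r : Euc k × Sph k =>
      deriv (transportMap σ μ ν r.2) (inner ℝ (r.2 : Euc k) (x + r.1))) (noise k σ) := by
  refine integrable_prod_of_integral_norm_le
    ((measurable_deriv_transportMap hσ μ ν).comp (f := fun r : Euc k × Sph k =>
      (r.2, inner ℝ (r.2 : Euc k) (x + r.1))) (by fun_prop)).aestronglyMeasurable
    (fun θ => integrable_deriv_transportMap_inner hσ μ ν θ x)
    fun θ => le_trans (le_of_eq ?_) (integral_deriv_transportMap_inner_le hσ μ ν x θ)
  exact integral_congr_ae (ae_of_all _ fun z =>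
    Real.norm_of_nonneg (monotone_transportMap hσ μ ν θ).deriv_nonneg)

lemma norm_fderiv_gradField_le (hσ : σ ≠ 0) (μ ν : P2 k) (x : Euc k) :
    ‖fderiv ℝ (gradField σ ν μ) x‖ ≤ 1 + ∫ r : Euc k × Sph k,
      deriv (transportMap σ μ ν r.2) (inner ℝ (r.2 : Euc k) (x + r.1)) ∂(noise k σ) := by
  have hderiv := integrable_deriv_transportMap_noise hσ μ ν x
  have hbound : Integrable (fun r : Euc k × Sph k => 1 +
      deriv (transportMap σ μ ν r.2) (inner ℝ (r.2 : Euc k) (x + r.1))) (noise k σ) :=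
    (integrable_const 1).add hderiv
  rw [(hasFDerivAt_gradField hσ ν μ x).fderiv,
    ← integral_prod _ (integrable_hessIntegrand hσ μ ν x)]
  refine (norm_integral_le_of_norm_le hbound
    (ae_of_all _ fun r => norm_hessIntegrand_le hσ μ ν x r.1 r.2)).trans_eq ?_
  rw [integral_add (integrable_const 1) hderiv, integral_const, probReal_univ, one_smul]

lemma integral_deriv_transportMap_noise (hσ : σ ≠ 0) (μ ν : P2 k) {x : Euc k}
    (hx : Integrable (fun r => transported σ μ ν id (x, r) *
      (inner ℝ (r.2 : Euc k) r.1 / σ ^ 2)) (noise k σ)) :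
    ∫ r : Euc k × Sph k,
        deriv (transportMap σ μ ν r.2) (inner ℝ (r.2 : Euc k) (x + r.1)) ∂(noise k σ) =
      ∫ r, transported σ μ ν id (x, r) * (inner ℝ (r.2 : Euc k) r.1 / σ ^ 2) ∂(noise k σ) := by
  rw [integral_prod_symm _ (integrable_deriv_transportMap_noise hσ μ ν x),
    integral_prod_symm _ hx]
  exact integral_congr_ae (ae_of_all _ fun θ =>
    integral_deriv_transportMap_inner_eq_integral_mul hσ μ ν θ x)

lemma integrable_transported_mul_score (hσ : σ ≠ 0) (μ ν : P2 k) :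
    Integrable (fun q => transported σ μ ν id q * (inner ℝ (q.2.2 : Euc k) q.2.1 / σ ^ 2))
      (μ.1.prod (noise k σ)) :=
  (memLp_transported hσ ν (MeasurePreserving.id μ.1)).integrable_mul
    (memLp_score.comp_measurePreserving measurePreserving_snd)

lemma integral_transported_mul_score_le (hσ : 0 < σ) (μ ν : P2 k) :
    ∫ q, transported σ μ ν id q * (inner ℝ (q.2.2 : Euc k) q.2.1 / σ ^ 2)
        ∂(μ.1.prod (noise k σ)) ≤
      1 / σ * √(∫ y, ‖y‖ ^ 2 ∂(reg σ ν.1)) := by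
  have hid := MeasurePreserving.id μ.1
  refine (integral_mul_le_sqrt_mul_sqrt (memLp_transported hσ.ne' ν hid)
    (memLp_score.comp_measurePreserving measurePreserving_snd)).trans ?_
  rw [Function.comp_def, integral_fun_snd
    (f := fun r : Euc k × Sph k => (inner ℝ (r.2 : Euc k) r.1 / σ ^ 2) ^ 2), probReal_univ,
    one_smul, integral_sq_score hσ.ne', Real.sqrt_sq (by positivity), mul_comm]
  gcongr
  exact integral_sq_transported_le hσ.ne' ν hid

lemma ae_norm_fderiv_gradField_le (hσ : σ ≠ 0) (μ ν : P2 k) :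
    ∀ᵐ x ∂μ.1, ‖fderiv ℝ (gradField σ ν μ) x‖ ≤ 1 + ∫ r, transported σ μ ν id (x, r) *
      (inner ℝ (r.2 : Euc k) r.1 / σ ^ 2) ∂(noise k σ) := by
  filter_upwards [(integrable_transported_mul_score hσ μ ν).prod_right_ae] with x hx
  rw [← integral_deriv_transportMap_noise hσ μ ν hx]
  exact norm_fderiv_gradField_le hσ μ ν x

theorem integrable_norm_fderiv_gradField (hσ : σ ≠ 0) (μ ν : P2 k) :
    Integrable (fun x => ‖fderiv ℝ (gradField σ ν μ) x‖) μ.1 := by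
  refine ((integrable_const 1).add
    (integrable_transported_mul_score hσ μ ν).integral_prod_left).mono'
    (measurable_fderiv ℝ _).norm.aestronglyMeasurable ?_
  simpa only [norm_norm, Pi.add_apply] using ae_norm_fderiv_gradField_le hσ μ ν

theorem integral_norm_fderiv_gradField_le (hσ : 0 < σ) (μ ν : P2 k) :
    ∫ x, ‖fderiv ℝ (gradField σ ν μ) x‖ ∂μ.1 ≤ 1 + 1 / σ * √(∫ y, ‖y‖ ^ 2 ∂(reg σ ν.1)) := by
  have hint := integrable_transported_mul_score hσ.ne' μ ν
  refine (integral_mono_ae (integrable_norm_fderiv_gradField hσ.ne' μ ν)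
    ((integrable_const 1).add hint.integral_prod_left)
    (ae_norm_fderiv_gradField_le hσ.ne' μ ν)).trans ?_
  refine (integral_add (integrable_const 1) hint.integral_prod_left).trans_le ?_
  rw [integral_const, probReal_univ, one_smul, ← integral_prod _ hint]
  gcongr
  exact integral_transported_mul_score_le hσ μ ν

end Bound

/-! ### Gradients of half squared norms -/

section Hilbert

variable {H K : Type*} [NormedAddCommGroup H] [InnerProductSpace ℝ H] [CompleteSpace H]
  [NormedAddCommGroup K] [InnerProductSpace ℝ K] [CompleteSpace K]
  {A : H → K} {S : H →L[ℝ] K} {w : H → ℝ}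

omit [CompleteSpace H] [CompleteSpace K] in
lemma abs_sub_sub_inner_le_of_half_norm_sq (hw : ∀ Y, w Y = ‖A Y‖ ^ 2 / 2)
    (hle : ∀ Y Z, w Z ≤ ‖A Y + S (Z - Y)‖ ^ 2 / 2) (X Y : H) :
    |w Y - w X - ⟪A X, S (Y - X)⟫| ≤
      (‖A Y - A X‖ + ‖S (Y - X)‖ / 2) * ‖S (Y - X)‖ := by
  have hupper := hle X Y
  have hlower := hle Y X
  rw [norm_add_sq_real] at hupper hlower
  rw [← neg_sub Y X, map_neg, inner_neg_right, norm_neg] at hlower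
  have hinner := abs_le.1 (abs_real_inner_le_norm (A Y - A X) (S (Y - X)))
  rw [inner_sub_left] at hinner
  have : 0 ≤ ‖A Y - A X‖ * ‖S (Y - X)‖ := by positivity
  rw [abs_le]
  constructor <;> linarith [hw X, hw Y, hinner.1, hinner.2]

open scoped InnerProduct in
/-- The supporting upper bounds at `X` and at `Y` squeeze the increment `w Y - w X` from both
sides. -/
lemma hasGradientAt_of_half_norm_sq {X : H} (hA : ContinuousAt A X)
    (hw : ∀ Y, w Y = ‖A Y‖ ^ 2 / 2) (hle : ∀ Y Z, w Z ≤ ‖A Y + S (Z - Y)‖ ^ 2 / 2) :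
    HasGradientAt w ((S†) (A X)) X := by
  rw [hasGradientAt_iff_isLittleO, Asymptotics.isLittleO_iff]
  intro c hc
  have hlim : Tendsto (fun Y => (‖A Y - A X‖ + ‖S‖ * ‖Y - X‖ / 2) * ‖S‖) (𝓝 X) (𝓝 0) := by
    have hcont : ContinuousAt (fun Y => (‖A Y - A X‖ + ‖S‖ * ‖Y - X‖ / 2) * ‖S‖) X := by fun_prop
    simpa using hcont.tendsto
  filter_upwards [hlim.eventually_le_const hc] with Y hY
  have hS := S.le_opNorm (Y - X)
  rw [ContinuousLinearMap.adjoint_inner_left, Real.norm_eq_abs]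
  calc |w Y - w X - ⟪A X, S (Y - X)⟫|
      ≤ (‖A Y - A X‖ + ‖S (Y - X)‖ / 2) * ‖S (Y - X)‖ :=
        abs_sub_sub_inner_le_of_half_norm_sq hw hle X Y
    _ ≤ (‖A Y - A X‖ + ‖S‖ * ‖Y - X‖ / 2) * (‖S‖ * ‖Y - X‖) := by gcongr
    _ = ((‖A Y - A X‖ + ‖S‖ * ‖Y - X‖ / 2) * ‖S‖) * ‖Y - X‖ := by ring
    _ ≤ c * ‖Y - X‖ := by gcongr

end Hilbert

/-! ### Square-integrable functions on products -/

section Product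

variable {α β γ : Type*} {mα : MeasurableSpace α} {mβ : MeasurableSpace β}
  {mγ : MeasurableSpace γ} {μ : Measure α} {ν : Measure β} {ρ : Measure γ}

lemma inner_toLp {E : Type*} [NormedAddCommGroup E] [InnerProductSpace ℝ E] {f g : α → E}
    (hf : MemLp f 2 μ) (hg : MemLp g 2 μ) :
    ⟪hf.toLp f, hg.toLp g⟫ = ∫ a, ⟪f a, g a⟫ ∂μ := by
  rw [L2.inner_def]
  refine integral_congr_ae ?_
  filter_upwards [hf.coeFn_toLp, hg.coeFn_toLp] with a hfa hga
  rw [hfa, hga]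

lemma norm_sq_toLp {f : α → ℝ} (hf : MemLp f 2 μ) : ‖hf.toLp f‖ ^ 2 = ∫ a, f a ^ 2 ∂μ := by
  rw [← real_inner_self_eq_norm_sq, inner_toLp]
  simp only [real_inner_self_eq_norm_sq, Real.norm_eq_abs, sq_abs]

lemma integrable_comp_prodAssoc {E : Type*} [NormedAddCommGroup E] [SFinite ν] [SFinite ρ]
    {f : α × (β × γ) → E} (hf : Integrable f (μ.prod (ν.prod ρ))) :
    Integrable (fun q : (α × β) × γ => f (q.1.1, (q.1.2, q.2))) ((μ.prod ν).prod ρ) :=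
  (measurePreserving_prodAssoc μ ν ρ).integrable_comp_of_integrable hf

variable {E : Type*} [NormedAddCommGroup E] [NormedSpace ℝ E]

lemma norm_integral_sq_le [IsProbabilityMeasure μ] {f : α → E} (hf : MemLp f 2 μ) :
    ‖∫ a, f a ∂μ‖ ^ 2 ≤ ∫ a, ‖f a‖ ^ 2 ∂μ := by
  have holder := integral_mul_le_sqrt_mul_sqrt hf.norm (memLp_const (1 : ℝ))
  simp only [mul_one, one_pow, integral_const, probReal_univ, one_smul, Real.sqrt_one] at holder
  exact (Real.le_sqrt (norm_nonneg _) (integral_nonneg fun a => sq_nonneg _)).1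
    ((norm_integral_le_integral_norm f).trans holder)

lemma memLp_integral_right [SFinite μ] [IsProbabilityMeasure ν] {f : α × β → E}
    (hf : MemLp f 2 (μ.prod ν)) : MemLp (fun a => ∫ b, f (a, b) ∂ν) 2 μ := by
  have hmeas := hf.aestronglyMeasurable.integral_prod_right'
  have hsq := hf.integrable_norm_pow two_ne_zero
  rw [memLp_two_iff_integrable_sq_norm hmeas]
  refine hsq.integral_prod_left.mono' (hmeas.norm.pow 2) ?_
  filter_upwards [hsq.prod_right_ae, hf.aestronglyMeasurable.prodMk_left] with a ha hma
  rw [Real.norm_of_nonneg (by positivity)]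
  exact norm_integral_sq_le ((memLp_two_iff_integrable_sq_norm hma).2 ha)

lemma integral_prod_prod_symm [SFinite μ] [SFinite ν] [SFinite ρ] {f : α × (β × γ) → E}
    (hf : Integrable f (μ.prod (ν.prod ρ))) :
    ∫ q, f q ∂(μ.prod (ν.prod ρ)) =
      ∫ c, ∫ p : α × β, f (p.1, (p.2, c)) ∂(μ.prod ν) ∂ρ := by
  rw [← (measurePreserving_prodAssoc μ ν ρ).integral_comp', integral_prod_symm]
  · rfl
  · exact integrable_comp_prodAssoc hf

end Product

/-! ### The residual of the transport -/

section Residual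

variable {k : ℕ} {σ : ℝ} {Ω : Type*} {mΩ : MeasurableSpace Ω} {P : Measure Ω}
  {μ μ' : P2 k} {X Y : Ω → Euc k}

/-- The displacement between the projection of `Y + N_σ` and the point to which the transport
built at `X` sends its partner: for `Y = X` it is the optimal displacement, for other `Y` that of
the coupling which moves `X` to `Y` and keeps the noise and the transport fixed. The law of `X` is
meant to be `μ`. -/
noncomputable def residual (σ : ℝ) (μ ν : P2 k) (X Y : Ω → Euc k) (q : Ω × (Euc k × Sph k)) : ℝ :=
  inner ℝ (q.2.2 : Euc k) (Y q.1 + q.2.1) - transported σ μ ν X q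

lemma measurePreserving_inner_add [SFinite P] (hX : MeasurePreserving X P μ.1) (θ : Sph k) :
    MeasurePreserving (fun p : Ω × Euc k => inner ℝ (θ : Euc k) (X p.1 + p.2))
      (P.prod (gauss k σ)) (slice θ (reg σ μ.1)) := by
  have hinner : MeasurePreserving (fun x : Euc k => inner ℝ (θ : Euc k) x) (reg σ μ.1)
      (slice θ (reg σ μ.1)) := ⟨by fun_prop, rfl⟩
  have hadd : MeasurePreserving (fun p : Euc k × Euc k => p.1 + p.2) (μ.1.prod (gauss k σ))
      (reg σ μ.1) := ⟨by fun_prop, rfl⟩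
  exact hinner.comp (hadd.comp (hX.prod (MeasurePreserving.id _)))

lemma measurePreserving_transported [SFinite P] (hσ : σ ≠ 0) (ν : P2 k)
    (hX : MeasurePreserving X P μ.1) (θ : Sph k) :
    MeasurePreserving (fun p : Ω × Euc k => transported σ μ ν X (p.1, (p.2, θ)))
      (P.prod (gauss k σ)) (slice θ (reg σ ν.1)) :=
  (measurePreserving_transportMap hσ μ ν θ).comp (measurePreserving_inner_add hX θ)

lemma W2sq_slice_reg_eq [SFinite P] (hσ : σ ≠ 0) (ν : P2 k) (hX : MeasurePreserving X P μ.1)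
    (θ : Sph k) :
    W2sq (slice θ (reg σ μ.1)) (slice θ (reg σ ν.1)) =
      ∫ p : Ω × Euc k, residual σ μ ν X X (p.1, (p.2, θ)) ^ 2 / 2 ∂(P.prod (gauss k σ)) := by
  have hinner := measurePreserving_inner_add (σ := σ) hX θ
  have hmeas := (measurePreserving_transportMap hσ μ ν θ).measurable
  rw [(regularCDF_slice_reg hσ θ μ.1).W2sq_eq (regularCDF_slice_reg hσ θ ν.1)
    (memLp_id_slice (memLp_id_reg μ.2.2) θ) (memLp_id_slice (memLp_id_reg ν.2.2) θ),
    ← transportMap_eq_monoMap, ← hinner.map_eq,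
    integral_map hinner.measurable.aemeasurable (by fun_prop)]
  rfl

variable [IsProbabilityMeasure P]

lemma W2sq_slice_reg_le (hσ : σ ≠ 0) (ν : P2 k) (hX : MeasurePreserving X P μ.1)
    (hY : MeasurePreserving Y P μ'.1) (θ : Sph k) :
    W2sq (slice θ (reg σ μ'.1)) (slice θ (reg σ ν.1)) ≤
      ∫ p : Ω × Euc k, residual σ μ ν X Y (p.1, (p.2, θ)) ^ 2 / 2 ∂(P.prod (gauss k σ)) := by
  have hinner := measurePreserving_inner_add (σ := σ) hY θ
  have htransported := measurePreserving_transported hσ ν hX θ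
  have hle := W2sq_map_le
    ((memLp_id_slice (memLp_id_reg μ'.2.2) θ).comp_measurePreserving hinner)
    ((memLp_id_slice (memLp_id_reg ν.2.2) θ).comp_measurePreserving htransported)
  simp only [Function.id_comp, hinner.map_eq, htransported.map_eq, Real.norm_eq_abs, sq_abs] at hle
  exact hle

variable [NeZero k]

lemma memLp_inner_add_noise (hY : MeasurePreserving Y P μ'.1) :
    MemLp (fun q : Ω × (Euc k × Sph k) => inner ℝ (q.2.2 : Euc k) (Y q.1 + q.2.1)) 2
      (P.prod (noise k σ)) := by
  have hYq : MemLp (fun q : Ω × (Euc k × Sph k) => Y q.1) 2 (P.prod (noise k σ)) :=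
    (μ'.2.2.comp_measurePreserving hY).comp_measurePreserving measurePreserving_fst
  have hnoise : MemLp (fun q : Ω × (Euc k × Sph k) => q.2.1) 2 (P.prod (noise k σ)) :=
    memLp_id_gauss.comp_measurePreserving (measurePreserving_fst.comp measurePreserving_snd)
  exact memLp_inner_sph (by fun_prop) (hYq.add hnoise)

lemma memLp_residual (hσ : σ ≠ 0) (ν : P2 k) (hX : MeasurePreserving X P μ.1)
    (hY : MeasurePreserving Y P μ'.1) :
    MemLp (residual σ μ ν X Y) 2 (P.prod (noise k σ)) :=
  (memLp_inner_add_noise hY).sub (memLp_transported hσ ν hX)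

lemma integrable_residual_sq (hσ : σ ≠ 0) (ν : P2 k) (hX : MeasurePreserving X P μ.1)
    (hY : MeasurePreserving Y P μ'.1) :
    Integrable (fun q => residual σ μ ν X Y q ^ 2 / 2) (P.prod (noise k σ)) :=
  (memLp_residual hσ ν hX hY).integrable_sq.div_const 2

lemma SW2regSq_eq_integral_residual (hσ : σ ≠ 0) (ν : P2 k) (hX : MeasurePreserving X P μ.1) :
    SW2regSq σ μ ν = ∫ q, residual σ μ ν X X q ^ 2 / 2 ∂(P.prod (noise k σ)) := by
  rw [integral_prod_prod_symm (integrable_residual_sq hσ ν hX hX)]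
  exact integral_congr_ae (ae_of_all _ (W2sq_slice_reg_eq hσ ν hX))

lemma SW2regSq_le_integral_residual (hσ : σ ≠ 0) (ν : P2 k) (hX : MeasurePreserving X P μ.1)
    (hY : MeasurePreserving Y P μ'.1) :
    SW2regSq σ μ' ν ≤ ∫ q, residual σ μ ν X Y q ^ 2 / 2 ∂(P.prod (noise k σ)) := by
  have hsq := integrable_residual_sq hσ ν hX hY
  rw [integral_prod_prod_symm hsq]
  refine integral_mono ?_ (integrable_comp_prodAssoc hsq).integral_prod_right
    (W2sq_slice_reg_le hσ ν hX hY)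
  simp only [W2sq_slice_reg_eq hσ ν hY]
  exact (integrable_comp_prodAssoc (integrable_residual_sq hσ ν hY hY)).integral_prod_right

end Residual

/-! ### Representation of the gradient -/

section Representation

variable {k : ℕ} {σ K : ℝ} {f : Sph k → ℝ → ℝ}

variable [NeZero k]

lemma integrable_comp_inner_noise (hσ : σ ≠ 0) (hf : ∀ θ, HasGaussianGrowth (sigmaSq σ) K (f θ))
    (hfm : Measurable fun p : Sph k × ℝ => f p.1 p.2) (x : Euc k) :
    Integrable (fun r : Euc k × Sph k => f r.2 (inner ℝ (r.2 : Euc k) (x + r.1)))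
      (noise k σ) := by
  have hfθ (θ : Sph k) : Measurable (f θ) := by fun_prop
  have hint (θ : Sph k) := (hf θ).integrable_mul_gaussianPDFReal (sigmaSq_ne_zero hσ) (hfθ θ)
    (inner ℝ (θ : Euc k) x)
  refine integrable_prod_of_integral_norm_le (C := ∫ t, gaussMajorant (sigmaSq σ) K ‖x‖ t)
    (hfm.comp (f := fun r : Euc k × Sph k =>
      (r.2, inner ℝ (r.2 : Euc k) (x + r.1))) (by fun_prop)).aestronglyMeasurable
    (fun θ => integrable_comp_inner hσ (hfθ θ) (hint θ)) fun θ => ?_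
  rw [integral_comp_inner hσ (f := fun t => ‖f θ t‖) (hfθ θ).norm]
  refine integral_mono_of_nonneg (ae_of_all _ fun t =>
    mul_nonneg (norm_nonneg _) (gaussianPDFReal_nonneg _ _ _))
    (integrable_gaussMajorant (sigmaSq_ne_zero hσ) K ‖x‖) (ae_of_all _ fun t => ?_)
  refine le_trans (le_of_eq ?_) ((hf θ).abs_mul_gaussianPDFReal_le (abs_inner_sph_le θ x) t)
  simp only [abs_mul, abs_of_nonneg (gaussianPDFReal_nonneg _ _ _), Real.norm_eq_abs]

lemma ridgeAverage_eq_integral_noise (hσ : σ ≠ 0)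
    (hf : ∀ θ, HasGaussianGrowth (sigmaSq σ) K (f θ))
    (hfm : Measurable fun p : Sph k × ℝ => f p.1 p.2) (x : Euc k) :
    ridgeAverage (sigmaSq σ) f x =
      ∫ r : Euc k × Sph k, f r.2 (inner ℝ (r.2 : Euc k) (x + r.1)) • (r.2 : Euc k)
        ∂(noise k σ) := by
  have hint : Integrable (fun r : Euc k × Sph k =>
      f r.2 (inner ℝ (r.2 : Euc k) (x + r.1)) • (r.2 : Euc k)) (noise k σ) := by
    refine (integrable_comp_inner_noise hσ hf hfm x).mono ?_ (ae_of_all _ fun r => ?_)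
    · exact (integrable_comp_inner_noise hσ hf hfm x).aestronglyMeasurable.smul
        (measurable_subtype_coe.comp measurable_snd).aestronglyMeasurable
    · rw [norm_smul, norm_eq_of_mem_sphere, mul_one]
  rw [ridgeAverage, integral_prod _ (integrable_ridge (sigmaSq_ne_zero hσ) hf hfm x),
    integral_prod_symm _ hint]
  refine integral_congr_ae (ae_of_all _ fun θ => ?_)
  have hfθ : Measurable (f θ) := by fun_prop
  simp only [integral_smul_const, integral_comp_inner hσ hfθ]

lemma gradField_eq_integral_residual (hσ : σ ≠ 0) (μ ν : P2 k) {Ω : Type*} (X : Ω → Euc k)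
    (ω : Ω) :
    gradField σ ν μ (X ω) =
      ∫ r, residual σ μ ν X X (ω, r) • (r.2 : Euc k) ∂(noise k σ) :=
  ridgeAverage_eq_integral_noise hσ (hasGaussianGrowth_sub_transportMap_self hσ μ ν)
    (measurable_sub_transportMap hσ μ ν) (X ω)

end Representation

/-! ### The lift to `L²` -/

section Lift

variable {k : ℕ} {σ : ℝ} {Ω : Type*} {mΩ : MeasurableSpace Ω} {P : Measure Ω}

lemma memLp_smul_sph {R : Ω × (Euc k × Sph k) → ℝ} (hR : MemLp R 2 (P.prod (noise k σ))) :
    MemLp (fun q => R q • (q.2.2 : Euc k)) 2 (P.prod (noise k σ)) :=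
  hR.mono (hR.aestronglyMeasurable.smul
    (measurable_subtype_coe.comp (measurable_snd.comp measurable_snd)).aestronglyMeasurable)
    (ae_of_all _ fun q => by rw [norm_smul, norm_eq_of_mem_sphere, mul_one])

lemma memLp_inner_fst [NeZero k] {X : Ω → Euc k} (hX : MemLp X 2 P) :
    MemLp (fun q : Ω × (Euc k × Sph k) => inner ℝ (q.2.2 : Euc k) (X q.1)) 2
      (P.prod (noise k σ)) :=
  memLp_inner_sph (by fun_prop) (hX.comp_measurePreserving measurePreserving_fst)

lemma norm_toLp_inner_fst_le [NeZero k] {X : Ω → Euc k} (hX : MemLp X 2 P) :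
    ‖(memLp_inner_fst (σ := σ) hX).toLp _‖ ≤ ‖hX.toLp X‖ := by
  rw [Lp.norm_toLp, Lp.norm_toLp, ← eLpNorm_comp_measurePreserving hX.aestronglyMeasurable
    (measurePreserving_fst (ν := noise k σ))]
  exact ENNReal.toReal_mono (hX.comp_measurePreserving measurePreserving_fst).eLpNorm_ne_top
    (eLpNorm_mono fun q => abs_inner_sph_le q.2.2 (X q.1))

variable [IsProbabilityMeasure P]

lemma measurePreserving_law (X : Lp (Euc k) 2 P) : MeasurePreserving X P (law P X).1 :=
  ⟨(Lp.stronglyMeasurable X).measurable, rfl⟩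

lemma W2_law_le (X Y : Lp (Euc k) 2 P) : W2 (law P Y) (law P X) ≤ ‖Y - X‖ := by
  have hle : W2sq (law P Y).1 (law P X).1 ≤ ∫ ω, ‖Y ω - X ω‖ ^ 2 / 2 ∂P :=
    W2sq_map_le (Lp.memLp Y) (Lp.memLp X)
  have hnorm : ‖Y - X‖ ^ 2 = ∫ ω, ‖Y ω - X ω‖ ^ 2 ∂P := by
    rw [← real_inner_self_eq_norm_sq, L2.inner_def]
    refine integral_congr_ae ?_
    filter_upwards [Lp.coeFn_sub Y X] with ω hω
    rw [hω, Pi.sub_apply, real_inner_self_eq_norm_sq]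
  rw [integral_div, ← hnorm] at hle
  exact Real.sqrt_le_iff.2 ⟨norm_nonneg _, by linarith [sq_nonneg ‖Y - X‖]⟩

lemma tendsto_W2_law (X : Lp (Euc k) 2 P) :
    Tendsto (fun Y => W2 (law P Y) (law P X)) (𝓝 X) (𝓝 0) :=
  squeeze_zero (fun _ => Real.sqrt_nonneg _) (W2_law_le X)
    (tendsto_iff_norm_sub_tendsto_zero.1 tendsto_id)

variable [NeZero k]

/-- The projection `X ↦ θᵀ X` of random vectors onto all directions at once. The noise is carried
along in the target because the projection is to be compared with functions of `X + N_σ`. -/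
noncomputable def projCLM (k : ℕ) [NeZero k] (σ : ℝ) (P : Measure Ω) [IsProbabilityMeasure P] :
    Lp (Euc k) 2 P →L[ℝ] Lp ℝ 2 (P.prod (noise k σ)) :=
  LinearMap.mkContinuous
    { toFun X := (memLp_inner_fst (Lp.memLp X)).toLp _
      map_add' X Y := by
        rw [← MemLp.toLp_add, MemLp.toLp_eq_toLp_iff]
        filter_upwards [Measure.quasiMeasurePreserving_fst.ae (Lp.coeFn_add X Y)] with q hq
        simp only [hq, Pi.add_apply, inner_add_right]
      map_smul' c X := by
        rw [RingHom.id_apply, ← MemLp.toLp_const_smul, MemLp.toLp_eq_toLp_iff]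
        filter_upwards [Measure.quasiMeasurePreserving_fst.ae (Lp.coeFn_smul c X)] with q hq
        simp only [hq, Pi.smul_apply, inner_smul_right, smul_eq_mul] }
    1 fun X => by
      rw [one_mul]
      exact (norm_toLp_inner_fst_le (Lp.memLp X)).trans_eq (by rw [Lp.toLp_coeFn])

lemma projCLM_apply (X : Lp (Euc k) 2 P) :
    projCLM k σ P X = (memLp_inner_fst (Lp.memLp X)).toLp _ := rfl

open scoped InnerProduct in
lemma adjoint_projCLM {R : Ω × (Euc k × Sph k) → ℝ} (hR : MemLp R 2 (P.prod (noise k σ))) :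
    ((projCLM k σ P)†) (hR.toLp R) = (memLp_integral_right (memLp_smul_sph hR)).toLp
      (fun ω => ∫ r, R (ω, r) • (r.2 : Euc k) ∂(noise k σ)) := by
  refine ext_inner_right ℝ fun X => ?_
  have hXq := memLp_inner_fst (σ := σ) (Lp.memLp X)
  have hsmul := (memLp_smul_sph hR).integrable one_le_two
  have hint : Integrable (fun q => ⟪R q, ⟪(q.2.2 : Euc k), X q.1⟫⟫) (P.prod (noise k σ)) :=
    hXq.integrable_mul hR
  have hX := inner_toLp (memLp_integral_right (memLp_smul_sph hR)) (Lp.memLp X)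
  rw [Lp.toLp_coeFn] at hX
  rw [ContinuousLinearMap.adjoint_inner_left, projCLM_apply, inner_toLp hR hXq, hX,
    integral_prod _ hint]
  refine integral_congr_ae ?_
  filter_upwards [hsmul.prod_right_ae] with ω hω
  rw [real_inner_comm, ← integral_inner hω]
  refine integral_congr_ae (ae_of_all _ fun r => ?_)
  simp only [inner_smul_right, real_inner_comm, RCLike.inner_apply, conj_trivial, mul_comm]

/-- The class in `L²` of the transport of the projections of `X + N_σ`. -/
noncomputable def transportedLp (hσ : σ ≠ 0) (ν : P2 k) (X : Lp (Euc k) 2 P) :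
    Lp ℝ 2 (P.prod (noise k σ)) :=
  (memLp_transported hσ ν (measurePreserving_law X)).toLp _

/-- The class in `L²` of the residual. -/
noncomputable def residualLp (hσ : σ ≠ 0) (ν : P2 k) (X Y : Lp (Euc k) 2 P) :
    Lp ℝ 2 (P.prod (noise k σ)) :=
  (memLp_residual hσ ν (measurePreserving_law X) (measurePreserving_law Y)).toLp _

lemma residualLp_add_projCLM (hσ : σ ≠ 0) (ν : P2 k) (X Y Z : Lp (Euc k) 2 P) :
    residualLp hσ ν X Y + projCLM k σ P (Z - Y) = residualLp hσ ν X Z := by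
  rw [map_sub, projCLM_apply, projCLM_apply, residualLp, residualLp, ← MemLp.toLp_sub,
    ← MemLp.toLp_add, MemLp.toLp_eq_toLp_iff]
  refine ae_of_all _ fun q => ?_
  simp only [residual, Pi.add_apply, Pi.sub_apply, inner_add_right]
  ring

lemma residualLp_sub_transportedLp (hσ : σ ≠ 0) (ν : P2 k) (X Y : Lp (Euc k) 2 P) :
    residualLp hσ ν X X + projCLM k σ P (Y - X) + transportedLp hσ ν X - transportedLp hσ ν Y =
      residualLp hσ ν Y Y := by
  rw [residualLp_add_projCLM, residualLp, residualLp, transportedLp, transportedLp,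
    ← MemLp.toLp_add, ← MemLp.toLp_sub, MemLp.toLp_eq_toLp_iff]
  refine ae_of_all _ fun q => ?_
  simp only [residual, Pi.add_apply, Pi.sub_apply]
  ring

lemma half_norm_sq_residualLp (hσ : σ ≠ 0) (ν : P2 k) (X Y : Lp (Euc k) 2 P) :
    ‖residualLp hσ ν X Y‖ ^ 2 / 2 =
      ∫ q, residual σ (law P X) ν X Y q ^ 2 / 2 ∂(P.prod (noise k σ)) := by
  rw [residualLp, norm_sq_toLp, integral_div]

/-- The transported projections all have the same law, hence are uniformly square integrable, so
that convergence almost everywhere along subsequences suffices. -/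
lemma continuous_transportedLp (hσ : σ ≠ 0) (ν : P2 k) :
    Continuous (transportedLp (P := P) hσ ν) := by
  refine continuous_iff_continuousAt.2 fun X => tendsto_of_subseq_tendsto fun Ys hYs => ?_
  obtain ⟨ms, hms, hae⟩ := (tendstoInMeasure_of_tendsto_Lp hYs).exists_seq_tendsto_ae
  have hW2 : Tendsto (fun n => W2 (law P (Ys (ms n))) (law P X)) atTop (𝓝 0) :=
    (tendsto_W2_law X).comp (hYs.comp hms.tendsto_atTop)
  have hmem (Y : Lp (Euc k) 2 P) := memLp_transported hσ ν (measurePreserving_law Y)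
  have hident (Y Z : Lp (Euc k) 2 P) :=
    (identDistrib_transported hσ ν (measurePreserving_law Y)).trans
      (identDistrib_transported hσ ν (measurePreserving_law Z)).symm
  have huniform := ProbabilityTheory.MemLp.uniformIntegrable_of_identDistrib
    (f := fun n => transported σ (law P (Ys (ms n))) ν (Ys (ms n))) one_le_two
    ENNReal.ofNat_ne_top (hmem (Ys (ms 0))) fun n => hident (Ys (ms n)) (Ys (ms 0))
  refine ⟨ms, (Lp.tendsto_Lp_iff_tendsto_eLpNorm'' _ (fun n => hmem _) _ (hmem X)).2 ?_⟩
  refine tendsto_Lp_finite_of_tendsto_ae one_le_two ENNReal.ofNat_ne_top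
    (fun n => (hmem _).aestronglyMeasurable) (hmem X) huniform.unifIntegrable ?_
  filter_upwards [Measure.quasiMeasurePreserving_fst.ae hae] with q hq
  exact tendsto_transportMap hσ ν hW2 tendsto_const_nhds
    (tendsto_const_nhds.inner (hq.add_const q.2.1))

lemma continuousAt_residualLp (hσ : σ ≠ 0) (ν : P2 k) (X : Lp (Euc k) 2 P) :
    ContinuousAt (fun Y => residualLp hσ ν Y Y) X := by
  have hcont := continuous_transportedLp (P := P) hσ ν
  have heq : (fun Y => residualLp hσ ν Y Y) = fun Y =>
      residualLp hσ ν X X + projCLM k σ P (Y - X) + transportedLp hσ ν X - transportedLp hσ ν Y :=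
    funext fun Y => (residualLp_sub_transportedLp hσ ν X Y).symm
  rw [heq]
  fun_prop

lemma memLp_gradField (hσ : σ ≠ 0) (ν : P2 k) (X : Lp (Euc k) 2 P) :
    MemLp (fun ω => gradField σ ν (law P X) (X ω)) 2 P := by
  simp only [gradField_eq_integral_residual hσ]
  have hX := measurePreserving_law X
  exact memLp_integral_right (memLp_smul_sph (memLp_residual hσ ν hX hX))

open scoped InnerProduct in
lemma adjoint_projCLM_residualLp (hσ : σ ≠ 0) (ν : P2 k) (X : Lp (Euc k) 2 P) :
    ((projCLM k σ P)†) (residualLp hσ ν X X) = (memLp_gradField hσ ν X).toLp _ := by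
  rw [residualLp, adjoint_projCLM, MemLp.toLp_eq_toLp_iff]
  exact ae_of_all _ fun ω => (gradField_eq_integral_residual hσ (law P X) ν X ω).symm

theorem isLDerivative_gradField (hσ : σ ≠ 0) (ν : P2 k) :
    IsLDerivative P (fun μ => SW2regSq σ μ ν) (gradField σ ν) := by
  refine ⟨jointlyContinuous_gradField hσ ν, fun X => ⟨memLp_gradField hσ ν X, ?_⟩⟩
  rw [← adjoint_projCLM_residualLp]
  refine hasGradientAt_of_half_norm_sq (A := fun Y => residualLp hσ ν Y Y)
    (continuousAt_residualLp hσ ν X) (fun Y => ?_) fun Y Z => ?_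
  · rw [half_norm_sq_residualLp]
    exact SW2regSq_eq_integral_residual hσ ν (measurePreserving_law Y)
  · rw [residualLp_add_projCLM, half_norm_sq_residualLp]
    exact SW2regSq_le_integral_residual hσ ν (measurePreserving_law Y) (measurePreserving_law Z)

end Lift

end SlicedW

theorem lemma3_general (k : ℕ) (hk : 1 ≤ k) (σ : ℝ) (hσ : 0 < σ) (ν : P2 k) :
    ∃ D : P2 k → Euc k → Euc k,
      (∀ (Ω : Type*) [MeasurableSpace Ω] (P : Measure Ω) [IsProbabilityMeasure P],
        IsLDerivative P (fun μ => SW2regSq σ μ ν) D) ∧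
      ∀ μ : P2 k,
        (∀ θ : Sph k, Differentiable ℝ (transportMap σ μ ν θ)) ∧
        (∀ x : Euc k,
          Integrable (fun p : Euc k × Sph k => hessIntegrand σ μ ν x p.1 p.2)
            ((gauss k σ).prod (unif k)) ∧
          HasFDerivAt (D μ) (∫ z, ∫ θ, hessIntegrand σ μ ν x z θ ∂(unif k) ∂(gauss k σ)) x) ∧
        Integrable (fun x => ‖fderiv ℝ (D μ) x‖) μ.1 ∧
        ∫ x, ‖fderiv ℝ (D μ) x‖ ∂μ.1 ≤
          1 + 1 / σ * Real.sqrt (∫ y, ‖y‖ ^ 2 ∂(reg σ ν.1)) := by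
  have : NeZero k := ⟨by omega⟩
  refine ⟨gradField σ ν, fun Ω _ P _ => isLDerivative_gradField hσ.ne' ν, fun μ =>
    ⟨differentiable_transportMap hσ.ne' μ ν, fun x => ⟨?integrable, ?hasFDerivAt⟩, ?bound⟩⟩
  case integrable => exact integrable_hessIntegrand hσ.ne' μ ν x
  case hasFDerivAt => exact hasFDerivAt_gradField hσ.ne' ν μ x
  case bound =>
    exact ⟨integrable_norm_fderiv_gradField hσ.ne' μ ν, integral_norm_fderiv_gradField_le hσ μ ν⟩

theorem lemma3 (k : ℕ) (hk : 1 ≤ k) :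
    ∃ C : ℝ, 0 < C ∧ ∀ (σ : ℝ), 0 < σ → ∀ ν : P2 k,
      ∃ D : P2 k → Euc k → Euc k,
        (∀ (Ω : Type*) [MeasurableSpace Ω] (P : Measure Ω) [IsProbabilityMeasure P],
          IsAtomless P → IsLDerivative P (fun μ => SW2regSq σ μ ν) D) ∧
        ∀ μ : P2 k,
          (∀ θ : Sph k, Differentiable ℝ (transportMap σ μ ν θ)) ∧
          (∀ x : Euc k,
            Integrable (fun p : Euc k × Sph k => hessIntegrand σ μ ν x p.1 p.2)
              ((gauss k σ).prod (unif k)) ∧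
            HasFDerivAt (D μ) (∫ z, ∫ θ, hessIntegrand σ μ ν x z θ ∂(unif k) ∂(gauss k σ)) x) ∧
          Integrable (fun x => ‖fderiv ℝ (D μ) x‖) μ.1 ∧
          ∫ x, ‖fderiv ℝ (D μ) x‖ ∂μ.1 ≤
            C * (1 + 1 / σ * Real.sqrt (∫ y, ‖y‖ ^ 2 ∂(reg σ ν.1))) := by
  refine ⟨1, one_pos, fun σ hσ ν => ?_⟩
  obtain ⟨D, hD, hμ⟩ := lemma3_general k hk σ hσ ν
  exact ⟨D, fun Ω _ P _ _ => hD Ω P, by simpa only [one_mul] using hμ⟩
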